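/- Consider a network with layers $\mathcal K=\{0,\dots,K\}$; layer $k$ has altitude $h_k$, association bias $B_k>0$, receiver density $\lambda_{k,\mathrm{Rx}}\ge 0$ and transmitter density $\lambda_{k,\mathrm{Tx}}\ge 0$. Put $h_{ik}=|h_i-h_k|$. A link of length $x\ge h_{ik}$ between a receiver of layer $i$ and a transmitter of layer $k$ is line-of-sight (L) with probability $\rho_{ik}^{(\mathrm L)}(x)\in[0,1]$ (a measurable function of $x$) and non-line-of-sight (N) with probability $\rho_{ik}^{(\mathrm N)}(x)=1-\rho_{ik}^{(\mathrm L)}(x)$; the pathloss exponents are $\alpha^{(\mathrm L)},\alpha^{(\mathrm N)}>0$. Let $o\in\{\mathrm r,\mathrm t\}$ be the association subject (receiver- or transmitter-oriented) and $a\in\{\mathrm n,\mathrm s\}$ the association criterion (nearest or strongest), and let $\tau=oa$. Fix a selecting node $\hat{\mathbf x}$ (a receiver if $o=\mathrm r$, a transmitter if $o=\mathrm t$). The candidate nodes of layer $k$ are the transmitters of layer $k$ if $o=\mathrm r$ and the receivers of layer $k$ if $o=\mathrm t$; they form a homogeneous Poisson point process on the plane at altitude $h_k$, of density $\lambda_{k,o}$,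 where $\lambda_{k,\mathrm r}=\lambda_{k,\mathrm{Tx}}$ and $\lambda_{k,\mathrm t}=\lambda_{k,\mathrm{Rx}}$, and the processes of different layers are independent. Given the locations, the L/N states of the links from $\hat{\mathbf x}$ are independent, with the above probabilities at the three-dimensional link lengths. The associated node $\mathbf x_\tau$ is a candidate $\mathbf x$, over all layers, that maximizes $B_k|\mathbf x-\hat{\mathbf x}|^{-1}$ if $a=\mathrm n$, and $B_k|\mathbf x-\hat{\mathbf x}|^{-\alpha^{(c_{\mathrm o})}}$ if $a=\mathrm s$, where $k$ is the layer of $\mathbf x$ and $c_{\mathrm o}$ is the state of its link (ties are broken arbitrarily). Consider main links between a receiver of layer $i$ and a transmitter of layer $j$ in state $c\in\{\mathrm L,\mathrm N\}$. Let $(p,q)$ be the layers of the selecting and of the selected node: $(p,q)=(i,j)$ if $o=\mathrm r$, and $(p,q)=(j,i)$ if $o=\mathrm t$; so $\hat{\mathbf x}$ is in layer $p$. Write $\varrho_{pk}^{(c_{\mathrm o})}=\rho_{pk}^{(c_{\mathrm o})}$ if $o=\mathrm r$ and $\varrho_{pk}^{(c_{\mathrm o})}=\rho_{kp}^{(c_{\mathrm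 o})}$ if $o=\mathrm t$. (1) For all $k\in\mathcal K$ and $c_{\mathrm o}\in\{\mathrm L,\mathrm N\}$, let $V_{pk,o}^{(c_{\mathrm o})}\in[0,\infty]$ be the distance from $\hat{\mathbf x}$ to the nearest candidate of layer $k$ whose link is in state $c_{\mathrm o}$ ($\infty$ if there is none). For all real $v$, $$\bar F_{V_{pk,o}^{(c_{\mathrm o})}}(v)=\mathbb P\big(V_{pk,o}^{(c_{\mathrm o})}>v\big)=\exp\Big[-\int_{h_{pk}}^{\max(v,h_{pk})}2\pi\lambda_{k,o}\,x\,\varrho_{pk}^{(c_{\mathrm o})}(x)\,dx\Big],$$ and on $\{V_{pk,o}^{(c_{\mathrm o})}<\infty\}$ the law of $V_{pk,o}^{(c_{\mathrm o})}$ has the (possibly defective) density $$f_{V_{pk,o}^{(c_{\mathrm o})}}(v)=2\pi\lambda_{k,o}\,v\,\varrho_{pk}^{(c_{\mathrm o})}(v)\exp\Big\{-\int_{h_{pk}}^{v}2\pi\lambda_{k,o}\,x\,\varrho_{pk}^{(c_{\mathrm o})}(x)\,dx\Big\}\ \text{ for } v\ge h_{pk},\qquad f_{V_{pk,o}^{(c_{\mathrm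 o})}}(v)=0\ \text{ for } v<h_{pk}.$$ (2) For $y>0$ let $$R_{k,c_{\mathrm o}}(y)=\begin{cases}y\,B_k/B_q & a=\mathrm n,\\ \big(y^{\alpha^{(c)}}B_k/B_q\big)^{1/\alpha^{(c_{\mathrm o})}} & a=\mathrm s.\end{cases}$$ The probability that the associated node lies in layer $q$ and its link is in state $c$ is $$\mathcal A_{ij,\tau}^{(c)}=\int_{x>0}f_{V_{pq,o}^{(c)}}(x)\prod_{(k,c_{\mathrm o})\ne(q,c)}\bar F_{V_{pk,o}^{(c_{\mathrm o})}}\big(R_{k,c_{\mathrm o}}(x)\big)\,dx,$$ where the product is over $k\in\mathcal K$ and $c_{\mathrm o}\in\{\mathrm L,\mathrm N\}$, and the integral converges. (3) If $\mathcal A_{ij,\tau}^{(c)}>0$, then, conditionally on the event in (2), the main link distance $Y_{ij,\tau}^{(c)}=|\mathbf x_\tau-\hat{\mathbf x}|$ has the probability density $$f_{Y_{ij,\tau}^{(c)}}(y)=\frac{f_{V_{pq,o}^{(c)}}(y)}{\mathcal A_{ij,\tau}^{(c)}}\prod_{(k,c_{\mathrm o})\ne(q,c)}\bar F_{V_{pk,o}^{(c_{\mathrm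 o})}}\big(R_{k,c_{\mathrm o}}(y)\big).$$ -/

import Mathlib

open MeasureTheory ProbabilityTheory
open scoped NNReal ENNReal

noncomputable section

namespace AerialNet

/-- State of a link: line of sight, or non line of sight. -/
inductive Channel
  | los
  | nlos
  deriving DecidableEq

instance : Fintype Channel where
  elems := {.los, .nlos}
  complete := by intro c; cases c <;> simp

/-- Role of a node. -/
inductive Role
  | rx
  | tx

/-- Association subject `o`: the end of the link that selects the other end. -/
inductive Subject
  | receiver
  | transmitter

/-- Association criterion `a`. -/
inductive Criterion
  | nearest
  | strongest

/-- Role of the nodes among which the association subject selects. -/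
def Subject.candidates : Subject → Role
  | .receiver => .tx
  | .transmitter => .rx

/-- Layer of the selecting end of a link from a `j`-layer transmitter to an `i`-layer receiver. -/
def Subject.selecting {ι : Type*} (o : Subject) (i j : ι) : ι :=
  match o with
  | .receiver => i
  | .transmitter => j

/-- Layer of the selected end of a link from a `j`-layer transmitter to an `i`-layer receiver. -/
def Subject.selected {ι : Type*} (o : Subject) (i j : ι) : ι :=
  match o with
  | .receiver => j
  | .transmitter => i

/-- The horizontal plane. -/
abbrev Plane : Type := EuclideanSpace ℝ (Fin 2)

/-- The point of three-dimensional space above `x` at altitude `h`. -/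
def atAltitude (x : Plane) (h : ℝ) : EuclideanSpace ℝ (Fin 3) := !₂[x 0, x 1, h]

/-- Parameters of a multi-layer aerial network with layers `0, …, K`. -/
structure Network (K : ℕ) where
  /-- altitude `h_k` -/
  altitude : Fin (K + 1) → ℝ
  /-- densities of the receivers and of the transmitters of a layer -/
  density : Role → Fin (K + 1) → ℝ≥0
  /-- association bias `B_k` -/
  bias : Fin (K + 1) → ℝ
  bias_pos : ∀ k, 0 < bias k
  /-- pathloss exponent `α^(c)` -/
  pathloss : Channel → ℝ
  pathloss_pos : ∀ c, 0 < pathloss c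
  /-- `losProb i j x` is the probability that a link of length `x` between an `i`-layer receiver
  and a `j`-layer transmitter is line of sight. -/
  losProb : Fin (K + 1) → Fin (K + 1) → ℝ → ℝ
  losProb_measurable : ∀ i j, Measurable (losProb i j)
  losProb_mem : ∀ i j x, |altitude i - altitude j| ≤ x → losProb i j x ∈ Set.Icc (0 : ℝ) 1

namespace Network

variable {K : ℕ}

/-- Altitude difference `h_{ij}`. -/
def gap (M : Network K) (i j : Fin (K + 1)) : ℝ := |M.altitude i - M.altitude j|

/-- `ρ_{ij}^(c) (x)` for an `i`-layer receiver and a `j`-layer transmitter. -/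
def channelProb (M : Network K) (i j : Fin (K + 1)) (c : Channel) (x : ℝ) : ℝ :=
  match c with
  | .los => M.losProb i j x
  | .nlos => 1 - M.losProb i j x

/-- Probability of channel `c` on a link of length `x` between a selecting node of layer `s` and a
candidate node of layer `k`. -/
def linkProb (M : Network K) (o : Subject) (s k : Fin (K + 1)) (c : Channel) (x : ℝ) : ℝ :=
  match o with
  | .receiver => M.channelProb s k c x
  | .transmitter => M.channelProb k s c x

/-- Length of the link between the selecting node, located in layer `s` above `u`, and a node
located in layer `k` above `x`. -/
def linkDist (M : Network K) (s : Fin (K + 1)) (u : Plane) (k : Fin (K + 1)) (x : Plane) : ℝ :=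
  dist (atAltitude x (M.altitude k)) (atAltitude u (M.altitude s))

/-- Association metric of a `k`-layer node at distance `d` whose link is in state `c`. It is
`ℝ≥0∞`-valued, so that it is infinite at distance zero. -/
def metric (M : Network K) (a : Criterion) (k : Fin (K + 1)) (c : Channel) (d : ℝ) : ℝ≥0∞ :=
  match a with
  | .nearest => ENNReal.ofReal (M.bias k) * (ENNReal.ofReal d)⁻¹
  | .strongest => ENNReal.ofReal (M.bias k) * ENNReal.ofReal d ^ (-M.pathloss c)

/-- The CCDF formula for the distance from a selecting node of layer `s` to the nearest candidate
of layer `k` in channel `c`. -/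
def nearestCCDF (M : Network K) (o : Subject) (s k : Fin (K + 1)) (c : Channel) (v : ℝ) : ℝ :=
  Real.exp (-∫ x in (M.gap s k)..(max v (M.gap s k)),
    2 * Real.pi * (M.density o.candidates k : ℝ) * x * M.linkProb o s k c x)

/-- The PDF formula for the distance from a selecting node of layer `s` to the nearest candidate
of layer `k` in channel `c`. -/
def nearestPDF (M : Network K) (o : Subject) (s k : Fin (K + 1)) (c : Channel) (v : ℝ) : ℝ :=
  if v < M.gap s k then 0 else
    2 * Real.pi * (M.density o.candidates k : ℝ) * v * M.linkProb o s k c v *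
      Real.exp (-∫ x in (M.gap s k)..v,
        2 * Real.pi * (M.density o.candidates k : ℝ) * x * M.linkProb o s k c x)

/-- `R(y)`: the exclusion distance for `k`-layer nodes in channel `c'` when the main link has
length `y`, goes to a node of layer `t` and is in channel `c`. -/
def exclusion (M : Network K) (a : Criterion) (t : Fin (K + 1)) (c : Channel)
    (k : Fin (K + 1)) (c' : Channel) (y : ℝ) : ℝ :=
  match a with
  | .nearest => y * M.bias k / M.bias t
  | .strongest => (y ^ M.pathloss c * M.bias k / M.bias t) ^ (1 / M.pathloss c')

/-- The nearest-node density of type `(t, c)` times the product of the CCDFs of all other types at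
their exclusion distances. -/
def mainLinkWeight (M : Network K) (o : Subject) (a : Criterion) (s t : Fin (K + 1)) (c : Channel)
    (y : ℝ) : ℝ :=
  M.nearestPDF o s t c y *
    ∏ p ∈ (Finset.univ : Finset (Fin (K + 1) × Channel)).erase (t, c),
      M.nearestCCDF o s p.1 p.2 (M.exclusion a t c p.1 p.2 y)

/-- The formula for the association probability. -/
def assocProb (M : Network K) (o : Subject) (a : Criterion) (s t : Fin (K + 1)) (c : Channel) :
    ℝ :=
  ∫ x in Set.Ioi (0 : ℝ), M.mainLinkWeight o a s t c x

/-- The formula for the PDF of the main link distance. -/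
def mainLinkPDF (M : Network K) (o : Subject) (a : Criterion) (s t : Fin (K + 1)) (c : Channel)
    (y : ℝ) : ℝ :=
  M.nearestPDF o s t c y / M.assocProb o a s t c *
    ∏ p ∈ (Finset.univ : Finset (Fin (K + 1) × Channel)).erase (t, c),
      M.nearestCCDF o s p.1 p.2 (M.exclusion a t c p.1 p.2 y)

end Network

/-- A random finite or infinite collection of points of the plane, with a measurable enumeration:
the points are `pt n` for `n < num`, and `pt n` is meaningless for the other `n`. -/
structure RandomPoints (Ω : Type*) [MeasurableSpace Ω] where
  num : Ω → ℕ∞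
  pt : ℕ → Ω → Plane
  measurable_num : Measurable num
  measurable_pt : ∀ n, Measurable (pt n)

namespace RandomPoints

variable {Ω : Type*} [MeasurableSpace Ω]

/-- Number of points in `A`. -/
def count (Φ : RandomPoints Ω) (A : Set Plane) (ω : Ω) : ℕ∞ :=
  Set.encard {n : ℕ | (n : ℕ∞) < Φ.num ω ∧ Φ.pt n ω ∈ A}

/-- The σ-algebra of the information on the locations of the points. -/
abbrev sigma (Φ : RandomPoints Ω) : MeasurableSpace Ω :=
  MeasurableSpace.comap Φ.num inferInstance ⊔
    ⨆ n, MeasurableSpace.comap (Φ.pt n) inferInstance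

/-- Homogeneous Poisson point process of density `lam`: the number of points in a Borel set of
finite area is Poisson with mean `lam` times the area, and the numbers of points in finitely many
disjoint such sets are independent. -/
structure IsPoisson (Φ : RandomPoints Ω) (P : Measure Ω) (lam : ℝ≥0) : Prop where
  law : ∀ A : Set Plane, MeasurableSet A → volume A ≠ ∞ → ∀ m : ℕ,
    P {ω | Φ.count A ω = m} = poissonMeasure (lam * (volume A).toNNReal) {m}
  indep : ∀ (r : ℕ) (A : Fin r → Set Plane), (∀ l, MeasurableSet (A l)) →
    (∀ l, volume (A l) ≠ ∞) → Pairwise (fun l l' => Disjoint (A l) (A l')) →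
    iIndepFun (fun l => Φ.count (A l)) P

end RandomPoints

section Links

variable {K : ℕ} {Ω : Type*} [MeasurableSpace Ω]

/-- `(k, n)` is one of the nodes. -/
def IsNode (Φ : Fin (K + 1) → RandomPoints Ω) (p : Fin (K + 1) × ℕ) (ω : Ω) : Prop :=
  (p.2 : ℕ∞) < (Φ p.1).num ω

/-- Distance of the node `(k, n)` to the selecting node, which is in layer `s` above `u`. -/
def nodeDist (M : Network K) (s : Fin (K + 1)) (u : Plane) (Φ : Fin (K + 1) → RandomPoints Ω)
    (p : Fin (K + 1) × ℕ) (ω : Ω) : ℝ :=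
  M.linkDist s u p.1 ((Φ p.1).pt p.2 ω)

/-- `state p` is the state of the link between the selecting node and node `p`. Given the
locations of all nodes, the states are independent, and a link of length `x` is in state `c` with
the probability that the network attributes to `c` at that length. -/
structure IsLinkState (M : Network K) (o : Subject) (s : Fin (K + 1)) (u : Plane)
    (Φ : Fin (K + 1) → RandomPoints Ω) (state : Fin (K + 1) × ℕ → Ω → Channel)
    (P : Measure Ω) : Prop where
  measurable : ∀ p c, MeasurableSet {ω | state p ω = c}
  cond : ∀ (S : Finset (Fin (K + 1) × ℕ)) (γ : Fin (K + 1) × ℕ → Channel),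
    ∀ᵐ ω ∂P, (∀ p ∈ S, IsNode Φ p ω) →
      (P[Set.indicator {ω' | ∀ p ∈ S, state p ω' = γ p} (fun _ => (1 : ℝ)) |
          ⨆ k, (Φ k).sigma]) ω =
        ∏ p ∈ S, M.linkProb o s p.1 (γ p) (nodeDist M s u Φ p ω)

/-- Distance from the selecting node to the nearest `k`-layer node whose link is in state `c`;
infinite if there is no such node. -/
def nearestDist (M : Network K) (s : Fin (K + 1)) (u : Plane) (Φ : Fin (K + 1) → RandomPoints Ω)
    (state : Fin (K + 1) × ℕ → Ω → Channel) (k : Fin (K + 1)) (c : Channel) (ω : Ω) : ℝ≥0∞ :=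
  ⨅ (n : ℕ) (_ : IsNode Φ (k, n) ω ∧ state (k, n) ω = c),
    ENNReal.ofReal (nodeDist M s u Φ (k, n) ω)

/-- `p` maximizes the association metric among all the nodes of all layers. -/
def IsBest (M : Network K) (a : Criterion) (s : Fin (K + 1)) (u : Plane)
    (Φ : Fin (K + 1) → RandomPoints Ω) (state : Fin (K + 1) × ℕ → Ω → Channel)
    (p : Fin (K + 1) × ℕ) (ω : Ω) : Prop :=
  IsNode Φ p ω ∧ ∀ q, IsNode Φ q ω →
    M.metric a q.1 (state q ω) (nodeDist M s u Φ q ω) ≤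
      M.metric a p.1 (state p ω) (nodeDist M s u Φ p ω)

/-- `sel` is almost surely a maximizer of the association metric, ties being broken arbitrarily,
and `none` if there is no maximizer. -/
def IsAssociation (M : Network K) (a : Criterion) (s : Fin (K + 1)) (u : Plane)
    (Φ : Fin (K + 1) → RandomPoints Ω) (state : Fin (K + 1) × ℕ → Ω → Channel)
    (sel : Ω → Option (Fin (K + 1) × ℕ)) (P : Measure Ω) : Prop :=
  ∀ᵐ ω ∂P, (∀ p, sel ω = some p → IsBest M a s u Φ state p ω) ∧
    (sel ω = none → ∀ p, ¬ IsBest M a s u Φ state p ω)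

/-- The event that the selected node is in layer `t` and its link is in state `c`. -/
def assocEvent (state : Fin (K + 1) × ℕ → Ω → Channel) (sel : Ω → Option (Fin (K + 1) × ℕ))
    (t : Fin (K + 1)) (c : Channel) : Set Ω :=
  {ω | ∃ n : ℕ, sel ω = some (t, n) ∧ state (t, n) ω = c}

/-- Distance to the selected node (zero if no node is selected). -/
def mainLinkDist (M : Network K) (s : Fin (K + 1)) (u : Plane)
    (Φ : Fin (K + 1) → RandomPoints Ω) (sel : Ω → Option (Fin (K + 1) × ℕ)) (ω : Ω) : ℝ :=
  match sel ω with
  | some p => nodeDist M s u Φ p ω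
  | none => 0

end Links

end AerialNet

end

/-!
Call the pair `(k, c)` of the layer of a candidate and the state of its link the type of the
candidate. Given the locations, the states are independent, so the conditional probability that
every candidate is farther away than a threshold `v (k, c)` depending on its type is a product over
the candidates. The expectation of such a product over a Poisson process `Φ` of density `lam` is
given by the generating functional `E ∏ g(x) = exp (-lam ∫ (1 - g))`, and polar coordinates turn the
exponent into a sum over the types. Hence the distances `V (k, c)` to the nearest candidates of the
`2 (K + 1)` types are independent and have the claimed CCDFs, and, these being exponentials of
integrals, the claimed densities.

A node of type `(t, c)` at distance `y` beats a node of type `p` exactly when the latter is farther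
away than the exclusion distance of `p` at `y`. Ties have probability zero since the `V p` are
independent and have no atoms at finite distances, so up to a null set the selected node is of type
`(t, c)` if and only if `V p` exceeds its exclusion distance at `V (t, c)` for all other types `p`,
and the main link then has length `V (t, c)`. Integrating over the law of `V (t, c)` gives the
association probability and the density of the main link distance.
-/

noncomputable section

namespace AerialNet

open Filter Topology

theorem absolutelyContinuousOnInterval_comp_of_lipschitzOnWith {X Y : Type*} [PseudoMetricSpace X]
    [PseudoMetricSpace Y] {f : ℝ → X} {g : X → Y} {a b : ℝ} {C : ℝ≥0} {t : Set X}
    (hg : LipschitzOnWith C g t) (hf : AbsolutelyContinuousOnInterval f a b)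
    (hft : Set.MapsTo f (Set.uIcc a b) t) :
    AbsolutelyContinuousOnInterval (fun x => g (f x)) a b := by
  rw [absolutelyContinuousOnInterval_iff] at hf ⊢
  intro ε hε
  obtain ⟨δ, hδ, hfδ⟩ := hf (ε / (C + 1)) (by positivity)
  refine ⟨δ, hδ, fun E hE hlen => ?_⟩
  calc ∑ i ∈ Finset.range E.1, dist (g (f (E.2 i).1)) (g (f (E.2 i).2))
      ≤ ∑ i ∈ Finset.range E.1, C * dist (f (E.2 i).1) (f (E.2 i).2) :=
        Finset.sum_le_sum fun i hi =>
          hg.dist_le_mul _ (hft (hE.1 i hi).1) _ (hft (hE.1 i hi).2)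
    _ = C * ∑ i ∈ Finset.range E.1, dist (f (E.2 i).1) (f (E.2 i).2) := by rw [Finset.mul_sum]
    _ ≤ C * (ε / (C + 1)) := by gcongr; exact (hfδ E hE hlen).le
    _ < (C + 1) * (ε / (C + 1)) := by gcongr; exact lt_add_one _
    _ = ε := by field

theorem intervalIntegral_mul_exp_neg {r : ℝ → ℝ} {a b : ℝ} (hr : IntervalIntegrable r volume a b) :
    ∫ x in a..b, r x * Real.exp (-∫ y in a..x, r y) = 1 - Real.exp (-∫ y in a..b, r y) := by
  have hprim : AbsolutelyContinuousOnInterval (fun x => ∫ y in a..x, r y) a b :=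
    hr.absolutelyContinuousOnInterval_intervalIntegral Set.left_mem_uIcc
  obtain ⟨C, hC⟩ := hprim.exists_bound
  have hexp : ContDiffOn ℝ 1 (fun z : ℝ => Real.exp (-z)) (Metric.closedBall 0 C) := by fun_prop
  obtain ⟨L, hL⟩ := hexp.exists_lipschitzOnWith one_ne_zero (convex_closedBall _ _)
    (isCompact_closedBall _ _)
  have hac : AbsolutelyContinuousOnInterval (fun x => Real.exp (-∫ y in a..x, r y)) a b :=
    absolutelyContinuousOnInterval_comp_of_lipschitzOnWith (g := fun z => Real.exp (-z)) hL hprim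
      fun x hx => mem_closedBall_zero_iff.2 (hC x hx)
  have hderiv : ∀ᵐ x, x ∈ Set.uIoc a b → r x * Real.exp (-∫ y in a..x, r y) =
      -deriv (fun x => Real.exp (-∫ y in a..x, r y)) x := by
    filter_upwards [hr.ae_hasDerivAt_integral] with x hx hxab
    rw [(hx (Set.uIoc_subset_uIcc hxab) a Set.left_mem_uIcc).fun_neg.exp.deriv]
    ring
  rw [intervalIntegral.integral_congr_ae hderiv, intervalIntegral.integral_neg,
    hac.integral_deriv_eq_sub, intervalIntegral.integral_same, neg_zero, Real.exp_zero, neg_sub]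

theorem image_sqrt_sq_add_sq_Ioi {h : ℝ} (hh : 0 ≤ h) :
    (fun y : ℝ => √(y ^ 2 + h ^ 2)) '' Set.Ioi 0 = Set.Ioi h := by
  ext r
  simp only [Set.mem_image, Set.mem_Ioi]
  constructor
  · rintro ⟨y, hy, rfl⟩
    exact Real.lt_sqrt_of_sq_lt (by nlinarith)
  · intro hr
    refine ⟨√(r ^ 2 - h ^ 2), Real.sqrt_pos.2 (by nlinarith), ?_⟩
    rw [Real.sq_sqrt (by nlinarith), sub_add_cancel, Real.sqrt_sq (by linarith)]

theorem integral_Ioi_comp_sqrt {h : ℝ} (hh : 0 ≤ h) (f : ℝ → ℝ) :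
    ∫ y in Set.Ioi (0 : ℝ), y * f √(y ^ 2 + h ^ 2) = ∫ r in Set.Ioi h, r * f r := by
  have hpos : ∀ y ∈ Set.Ioi (0 : ℝ), 0 < y ^ 2 + h ^ 2 := fun y (hy : 0 < y) => by positivity
  have hderiv : ∀ y ∈ Set.Ioi (0 : ℝ), HasDerivWithinAt (fun y => √(y ^ 2 + h ^ 2))
      (y / √(y ^ 2 + h ^ 2)) (Set.Ioi 0) y := fun y hy => by
    have hsqrt := ((hasDerivAt_pow 2 y).add_const (h ^ 2)).sqrt (hpos y hy).ne'
    rw [Nat.cast_ofNat, pow_one, mul_div_mul_left _ _ two_ne_zero] at hsqrt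
    exact hsqrt.hasDerivWithinAt
  have hinj : Set.InjOn (fun y : ℝ => √(y ^ 2 + h ^ 2)) (Set.Ioi 0) :=
    fun x (hx : 0 < x) y (hy : 0 < y) hxy => by
      nlinarith [(Real.sqrt_inj (hpos x hx).le (hpos y hy).le).1 hxy]
  rw [← image_sqrt_sq_add_sq_Ioi hh,
    integral_image_eq_integral_abs_deriv_smul measurableSet_Ioi hderiv hinj]
  refine setIntegral_congr_fun measurableSet_Ioi fun y (hy : 0 < y) => ?_
  have hsqrt : √(y ^ 2 + h ^ 2) ≠ 0 := (Real.sqrt_pos.2 (hpos y hy)).ne'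
  rw [smul_eq_mul, abs_of_nonneg (by positivity), ← mul_assoc, div_mul_cancel₀ _ hsqrt]

namespace RandomPoints

variable {Ω : Type*} [MeasurableSpace Ω]

theorem sigma_le (Φ : RandomPoints Ω) : Φ.sigma ≤ ‹MeasurableSpace Ω› :=
  sup_le Φ.measurable_num.comap_le (iSup_le fun n => (Φ.measurable_pt n).comap_le)

theorem measurable_pt_sigma (Φ : RandomPoints Ω) (n : ℕ) : Measurable[Φ.sigma] (Φ.pt n) :=
  (comap_measurable (Φ.pt n)).mono
    ((le_iSup (fun n => MeasurableSpace.comap (Φ.pt n) inferInstance) n).trans le_sup_right) le_rfl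

theorem measurableSet_lt_num_sigma (Φ : RandomPoints Ω) (n : ℕ) :
    MeasurableSet[Φ.sigma] {ω | (n : ℕ∞) < Φ.num ω} :=
  ((comap_measurable Φ.num).mono le_sup_left le_rfl) (.of_discrete (s := Set.Ioi (n : ℕ∞)))

/-- The indices of the points in `A`, the set whose cardinality is `Φ.count A`. -/
def indicesIn (Φ : RandomPoints Ω) (A : Set Plane) (ω : Ω) : Set ℕ :=
  {n | (n : ℕ∞) < Φ.num ω ∧ Φ.pt n ω ∈ A}

theorem measurable_count (Φ : RandomPoints Ω) {A : Set Plane} (hA : MeasurableSet A) :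
    Measurable (Φ.count A) :=
  measurable_encard.comp (f := Φ.indicesIn A) <| measurable_set_iff.2 fun n =>
    measurable_mem.2 <|
      (Φ.sigma_le _ (Φ.measurableSet_lt_num_sigma n)).inter (Φ.measurable_pt n hA)

/-- The product of the values of `g` at the points in `D`, whose expectation is the generating
functional; it is one, by the convention for `finprod`, if infinitely many of these values differ
from one. -/
def prodOver (Φ : RandomPoints Ω) (D : Set Plane) (g : Plane → ℝ) (ω : Ω) : ℝ :=
  ∏ᶠ n ∈ Φ.indicesIn D ω, g (Φ.pt n ω)

/-- The value of `g` at the point number `n`, or one if there is no such point: the `n`-th factor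
of the product over all points, defined for every `n`. -/
def mark (Φ : RandomPoints Ω) (g : Plane → ℝ) (n : ℕ) (ω : Ω) : ℝ :=
  open Classical in if (n : ℕ∞) < Φ.num ω then g (Φ.pt n ω) else 1

variable {Φ : RandomPoints Ω} {D : Set Plane} {g : Plane → ℝ} {ω : Ω}

theorem measurable_mark_sigma (Φ : RandomPoints Ω) (hg : Measurable g) (n : ℕ) :
    Measurable[Φ.sigma] (Φ.mark g n) :=
  Measurable.ite (Φ.measurableSet_lt_num_sigma n) (hg.comp (Φ.measurable_pt_sigma n))
    measurable_const

theorem mark_mem_Icc (hg : ∀ x, g x ∈ Set.Icc (0 : ℝ) 1) (n : ℕ) :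
    Φ.mark g n ω ∈ Set.Icc (0 : ℝ) 1 := by
  unfold mark
  split_ifs
  · exact hg _
  · simp

theorem prodOver_mem_Icc (hg : ∀ x, g x ∈ Set.Icc (0 : ℝ) 1) :
    Φ.prodOver D g ω ∈ Set.Icc (0 : ℝ) 1 :=
  finprod_mem_induction (· ∈ Set.Icc (0 : ℝ) 1) (by simp)
    (fun _ _ hx hy => ⟨mul_nonneg hx.1 hy.1, mul_le_one₀ hx.2 hy.1 hy.2⟩) fun _ _ => hg _

theorem prodOver_eq_prod_pow (hfin : Φ.count D ω ≠ ⊤) (f : SimpleFunc Plane ℝ) :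
    Φ.prodOver D f ω = ∏ y ∈ f.range, y ^ (Φ.count (D ∩ f ⁻¹' {y}) ω).toNat := by
  have hD : (Φ.indicesIn D ω).Finite := Set.encard_ne_top_iff.1 hfin
  rw [prodOver, finprod_mem_eq_finite_toFinset_prod _ hD,
    ← Finset.prod_fiberwise_of_maps_to (g := fun n => f (Φ.pt n ω)) fun n _ => f.mem_range_self _]
  refine Finset.prod_congr rfl fun y _ => ?_
  rw [Finset.prod_congr rfl fun n hn => (Finset.mem_filter.1 hn).2, Finset.prod_const]
  congr 1
  rw [← ENat.toNat_natCast (Finset.card _), ← Set.encard_coe_eq_coe_finsetCard]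
  congr 2
  ext n
  simp [indicesIn, and_assoc]

theorem tendsto_prodOver (hfin : Φ.count D ω ≠ ⊤) {f : ℕ → Plane → ℝ}
    (hf : ∀ x, Tendsto (fun m => f m x) atTop (𝓝 (g x))) :
    Tendsto (fun m => Φ.prodOver D (f m) ω) atTop (𝓝 (Φ.prodOver D g ω)) := by
  have hD : (Φ.indicesIn D ω).Finite := Set.encard_ne_top_iff.1 hfin
  simp only [prodOver, finprod_mem_eq_finite_toFinset_prod _ hD]
  exact tendsto_finsetProd _ fun n _ => hf _

theorem eventually_prod_mark_eq_prodOver (hfin : Φ.count D ω ≠ ⊤) (hg : ∀ x ∉ D, g x = 1) :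
    ∀ᶠ N in atTop, ∏ n ∈ Finset.range N, Φ.mark g n ω = Φ.prodOver D g ω := by
  classical
  have hD : (Φ.indicesIn D ω).Finite := Set.encard_ne_top_iff.1 hfin
  have hmark : ∀ n, Φ.mark g n ω = if n ∈ hD.toFinset then g (Φ.pt n ω) else 1 := fun n => by
    by_cases hn : (n : ℕ∞) < Φ.num ω <;> by_cases hx : Φ.pt n ω ∈ D <;>
      simp [mark, indicesIn, hn, hx, hg]
  obtain ⟨N₀, hN₀⟩ := hD.toFinset.exists_nat_subset_range
  filter_upwards [eventually_ge_atTop N₀] with N hN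
  rw [prodOver, finprod_mem_eq_finite_toFinset_prod _ hD, Finset.prod_congr rfl fun n _ => hmark n,
    Finset.prod_ite_mem, Finset.inter_eq_right.2 (hN₀.trans (Finset.range_mono hN))]

variable {P : Measure Ω} {lam : ℝ≥0}

theorem IsPoisson.iIndepFun_count {ι : Type*} [Finite ι] (h : Φ.IsPoisson P lam)
    {A : ι → Set Plane} (hA : ∀ l, MeasurableSet (A l)) (hvol : ∀ l, volume (A l) ≠ ∞)
    (hdisj : Pairwise fun l l' => Disjoint (A l) (A l')) :
    iIndepFun (fun l => Φ.count (A l)) P := by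
  obtain ⟨r, ⟨e⟩⟩ := Finite.exists_equiv_fin ι
  simpa using (h.indep r (A ∘ e.symm) (fun _ => hA _) (fun _ => hvol _)
    fun _ _ hne => hdisj (e.symm.injective.ne hne)).precomp e.injective

variable [IsProbabilityMeasure P]

theorem IsPoisson.map_count (h : Φ.IsPoisson P lam) {A : Set Plane}
    (hA : MeasurableSet A) (hvol : volume A ≠ ∞) :
    P.map (Φ.count A) = (poissonMeasure (lam * (volume A).toNNReal)).map (Nat.cast : ℕ → ℕ∞) := by
  have hcount := Φ.measurable_count hA
  have := Measure.isProbabilityMeasure_map (μ := P) hcount.aemeasurable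
  have hle : (poissonMeasure (lam * (volume A).toNNReal)).map (Nat.cast : ℕ → ℕ∞) ≤
      P.map (Φ.count A) := by
    refine Measure.le_iff.2 fun s hs => ?_
    rw [Measure.map_apply .of_discrete hs,
      ← Measure.tsum_indicator_apply_singleton _ _ .of_discrete,
      ← Measure.tsum_indicator_apply_singleton (P.map (Φ.count A)) _ hs]
    refine le_trans (ENNReal.tsum_le_tsum fun n => ?_)
      (ENNReal.tsum_comp_le_tsum_of_injective (Nat.cast_injective (R := ℕ∞)) _)
    by_cases hn : (n : ℕ∞) ∈ s
    · rw [Set.indicator_of_mem (by simpa using hn), Set.indicator_of_mem hn,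
        Measure.map_apply hcount .of_discrete, ← h.law A hA hvol n]
      rfl
    · rw [Set.indicator_of_notMem (by simpa using hn)]
      exact zero_le
  exact (Measure.eq_of_le_of_measure_univ_eq hle (by simp)).symm

theorem IsPoisson.ae_count_ne_top (h : Φ.IsPoisson P lam) {A : Set Plane} (hA : MeasurableSet A)
    (hvol : volume A ≠ ∞) : ∀ᵐ ω ∂P, Φ.count A ω ≠ ⊤ := by
  refine ae_of_ae_map (Φ.measurable_count hA).aemeasurable (p := (· ≠ ⊤)) ?_
  rw [h.map_count hA hvol, ae_map_iff Measurable.of_discrete.aemeasurable .of_discrete]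
  exact ae_of_all _ ENat.natCast_ne_top

theorem IsPoisson.integral_pow_count (h : Φ.IsPoisson P lam) {A : Set Plane}
    (hA : MeasurableSet A) (hvol : volume A ≠ ∞) (z : ℝ) :
    ∫ ω, z ^ (Φ.count A ω).toNat ∂P = Real.exp (-(lam * (volume.real A * (1 - z)))) := by
  set r : ℝ≥0 := lam * (volume A).toNNReal with hr
  calc ∫ ω, z ^ (Φ.count A ω).toNat ∂P
      = ∫ m, z ^ (m : ℕ∞).toNat ∂(P.map (Φ.count A)) :=
        (integral_map (f := fun m : ℕ∞ => z ^ m.toNat) (Φ.measurable_count hA).aemeasurable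
          Measurable.of_discrete.aestronglyMeasurable).symm
    _ = ∑' n : ℕ, Real.exp (-r) * ((r * z) ^ n / n.factorial) := by
        rw [h.map_count hA hvol, integral_map_cast_poissonMeasure]
        refine tsum_congr fun n => ?_
        rw [ENat.toNat_natCast, smul_eq_mul, mul_pow]
        ring
    _ = Real.exp (-(lam * (volume.real A * (1 - z)))) := by
        rw [tsum_mul_left, (NormedSpace.expSeries_div_hasSum_exp (r * z : ℝ)).tsum_eq,
          ← Real.exp_eq_exp_ℝ, ← Real.exp_add]
        simp only [hr, NNReal.coe_mul, ENNReal.coe_toNNReal_eq_toReal, measureReal_def]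
        ring_nf

theorem setIntegral_one_sub_simpleFunc (hvol : volume D ≠ ∞) (f : SimpleFunc Plane ℝ) :
    ∫ x in D, (1 - f x) = ∑ y ∈ f.range, volume.real (D ∩ f ⁻¹' {y}) * (1 - y) := by
  have : IsFiniteMeasure (volume.restrict D) := isFiniteMeasure_restrict.2 hvol
  have hfib : ∀ y, (volume.restrict D).real (f ⁻¹' {y}) = volume.real (D ∩ f ⁻¹' {y}) := fun y => by
    rw [measureReal_restrict_apply (f.measurableSet_fiber y), Set.inter_comm]
  calc ∫ x in D, (1 - f x)
      = (volume.restrict D).real Set.univ - ∫ x in D, f x := by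
        rw [integral_sub (integrable_const 1) f.integrable_of_isFiniteMeasure, integral_const,
          smul_eq_mul, mul_one]
    _ = ∑ y ∈ f.range, (volume.restrict D).real (f ⁻¹' {y}) * (1 - y) := by
        rw [f.integral_eq_sum f.integrable_of_isFiniteMeasure, ← Set.preimage_range f,
          ← f.coe_range, ← sum_measureReal_preimage_singleton _ fun y _ => f.measurableSet_fiber y,
          ← Finset.sum_sub_distrib]
        simp_rw [smul_eq_mul, mul_one_sub]
    _ = ∑ y ∈ f.range, volume.real (D ∩ f ⁻¹' {y}) * (1 - y) := by simp_rw [hfib]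

theorem IsPoisson.aestronglyMeasurable_prodOver_simpleFunc (h : Φ.IsPoisson P lam)
    (hD : MeasurableSet D) (hvol : volume D ≠ ∞) (f : SimpleFunc Plane ℝ) :
    AEStronglyMeasurable (Φ.prodOver D f) P := by
  have hmeas : Measurable fun ω => ∏ y ∈ f.range, y ^ (Φ.count (D ∩ f ⁻¹' {y}) ω).toNat :=
    Finset.measurable_fun_prod _ fun y _ => (Measurable.of_discrete (f := fun m : ℕ∞ =>
      y ^ m.toNat)).comp (Φ.measurable_count (hD.inter (f.measurableSet_fiber y)))
  refine hmeas.aestronglyMeasurable.congr ?_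
  filter_upwards [h.ae_count_ne_top hD hvol] with ω hω
  exact (prodOver_eq_prod_pow hω f).symm

theorem IsPoisson.integral_prodOver_simpleFunc (h : Φ.IsPoisson P lam) (hD : MeasurableSet D)
    (hvol : volume D ≠ ∞) (f : SimpleFunc Plane ℝ) :
    ∫ ω, Φ.prodOver D f ω ∂P = Real.exp (-(lam * ∫ x in D, (1 - f x))) := by
  have hmeas : ∀ y, MeasurableSet (D ∩ f ⁻¹' {y}) := fun y => hD.inter (f.measurableSet_fiber y)
  have hfin : ∀ y, volume (D ∩ f ⁻¹' {y}) ≠ ∞ := fun y => measure_inter_ne_top_of_left_ne_top hvol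
  have hindep : iIndepFun (fun y : f.range => Φ.count (D ∩ f ⁻¹' {y.1})) P :=
    h.iIndepFun_count (fun y => hmeas y) (fun y => hfin y) fun y y' hne =>
      ((Set.disjoint_singleton.2 (Subtype.coe_ne_coe.2 hne)).preimage f).mono
        Set.inter_subset_right Set.inter_subset_right
  calc ∫ ω, Φ.prodOver D f ω ∂P
      = ∫ ω, ∏ y : f.range, (y : ℝ) ^ (Φ.count (D ∩ f ⁻¹' {y.1}) ω).toNat ∂P := by
        refine integral_congr_ae ?_
        filter_upwards [h.ae_count_ne_top hD hvol] with ω hω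
        rw [prodOver_eq_prod_pow hω, ← Finset.prod_coe_sort]
    _ = ∏ y : f.range, ∫ ω, (y : ℝ) ^ (Φ.count (D ∩ f ⁻¹' {y.1}) ω).toNat ∂P :=
        hindep.integral_fun_prod_comp (f := fun (y : f.range) (m : ℕ∞) => (y : ℝ) ^ m.toNat)
          (fun y => (Φ.measurable_count (hmeas y)).aemeasurable)
          fun y => Measurable.of_discrete.aestronglyMeasurable
    _ = Real.exp (-(lam * ∫ x in D, (1 - f x))) := by
        simp_rw [fun y => h.integral_pow_count (hmeas y) (hfin y) y]
        rw [Finset.prod_coe_sort f.range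
            (fun y => Real.exp (-(lam * (volume.real (D ∩ f ⁻¹' {y}) * (1 - y))))),
          ← Real.exp_sum, Finset.sum_neg_distrib, ← Finset.mul_sum,
          setIntegral_one_sub_simpleFunc hvol]

theorem IsPoisson.integral_prodOver (h : Φ.IsPoisson P lam) (hD : MeasurableSet D)
    (hvol : volume D ≠ ∞) (hg : Measurable g) (hg01 : ∀ x, g x ∈ Set.Icc (0 : ℝ) 1) :
    ∫ ω, Φ.prodOver D g ω ∂P = Real.exp (-(lam * ∫ x in D, (1 - g x))) := by
  let f : ℕ → SimpleFunc Plane ℝ := SimpleFunc.approxOn g hg (Set.Icc 0 1) 0 (by simp)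
  have hf : ∀ m x, f m x ∈ Set.Icc (0 : ℝ) 1 := SimpleFunc.approxOn_mem hg _
  have hlim : ∀ x, Tendsto (fun m => f m x) atTop (𝓝 (g x)) := fun x =>
    SimpleFunc.tendsto_approxOn hg _ (subset_closure (hg01 x))
  refine tendsto_nhds_unique (f := fun m => ∫ ω, Φ.prodOver D (f m) ω ∂P) (l := atTop) ?_ ?_
  · refine tendsto_integral_of_dominated_convergence (fun _ => 1) (fun m => ?_)
      (integrable_const 1) (fun m => ae_of_all _ fun ω => ?_) ?_
    · exact h.aestronglyMeasurable_prodOver_simpleFunc hD hvol (f m)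
    · rw [Real.norm_of_nonneg (prodOver_mem_Icc (hf m)).1]
      exact (prodOver_mem_Icc (hf m)).2
    · filter_upwards [h.ae_count_ne_top hD hvol] with ω hω
      exact tendsto_prodOver hω hlim
  · simp_rw [h.integral_prodOver_simpleFunc hD hvol]
    have : Fact (volume D < ∞) := ⟨hvol.lt_top⟩
    refine (Real.continuous_exp.tendsto _).comp (Tendsto.neg (Tendsto.const_mul _ ?_))
    refine tendsto_integral_of_dominated_convergence (fun _ => 1)
      (fun m => ((f m).measurable.const_sub 1).aestronglyMeasurable) (integrable_const 1)
      (fun m => ae_of_all _ fun x => ?_) (ae_of_all _ fun x => (hlim x).const_sub 1)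
    rw [Real.norm_of_nonneg (by linarith [(hf m x).2])]
    linarith [(hf m x).1]

theorem IsPoisson.tendsto_integral_prod_mark (h : Φ.IsPoisson P lam) (hD : MeasurableSet D)
    (hvol : volume D ≠ ∞) (hg : Measurable g) (hg01 : ∀ x, g x ∈ Set.Icc (0 : ℝ) 1)
    (hgD : ∀ x ∉ D, g x = 1) :
    Tendsto (fun N => ∫ ω, ∏ n ∈ Finset.range N, Φ.mark g n ω ∂P) atTop
      (𝓝 (Real.exp (-(lam * ∫ x, (1 - g x))))) := by
  rw [← setIntegral_eq_integral_of_forall_compl_eq_zero (s := D) fun x hx => by simp [hgD x hx],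
    ← h.integral_prodOver hD hvol hg hg01]
  refine tendsto_integral_of_dominated_convergence (fun _ => 1) (fun N => ?_)
    (integrable_const 1) (fun N => ae_of_all _ fun ω => ?_) ?_
  · exact (Finset.measurable_fun_prod _ fun n _ =>
      (Φ.measurable_mark_sigma hg n).mono Φ.sigma_le le_rfl).aestronglyMeasurable
  · rw [Real.norm_of_nonneg (Finset.prod_nonneg fun n _ => (mark_mem_Icc hg01 n).1)]
    exact Finset.prod_le_one (fun n _ => (mark_mem_Icc hg01 n).1) fun n _ => (mark_mem_Icc hg01 n).2
  · filter_upwards [h.ae_count_ne_top hD hvol] with ω hω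
    exact tendsto_nhds_of_eventually_eq (eventually_prod_mark_eq_prodOver hω hgD)

end RandomPoints

namespace Network

variable {K : ℕ} (M : Network K) (o : Subject) (s k : Fin (K + 1)) (u : Plane)

theorem gap_nonneg : 0 ≤ M.gap s k := abs_nonneg _

theorem linkDist_eq_sqrt (x : Plane) :
    M.linkDist s u k x = √(‖x - u‖ ^ 2 + M.gap s k ^ 2) := by
  rw [linkDist, EuclideanSpace.dist_eq, Fin.sum_univ_three, ← dist_eq_norm,
    EuclideanSpace.dist_eq, Fin.sum_univ_two, Real.sq_sqrt (by positivity)]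
  simp [atAltitude, gap, Real.dist_eq, abs_sub_comm (M.altitude k)]

theorem continuous_linkDist : Continuous (M.linkDist s u k) := by
  simp_rw [funext (M.linkDist_eq_sqrt s k u)]
  fun_prop

theorem gap_le_linkDist (x : Plane) : M.gap s k ≤ M.linkDist s u k x := by
  rw [linkDist_eq_sqrt]
  exact Real.le_sqrt_of_sq_le (le_add_of_nonneg_left (sq_nonneg _))

theorem linkDist_nonneg (x : Plane) : 0 ≤ M.linkDist s u k x := dist_nonneg

theorem norm_sub_le_linkDist (x : Plane) : ‖x - u‖ ≤ M.linkDist s u k x := by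
  rw [linkDist_eq_sqrt]
  exact Real.le_sqrt_of_sq_le (le_add_of_nonneg_right (sq_nonneg _))

theorem measurable_linkProb (c : Channel) : Measurable (M.linkProb o s k c) := by
  cases o <;> cases c
  · exact M.losProb_measurable s k
  · exact (M.losProb_measurable s k).const_sub 1
  · exact M.losProb_measurable k s
  · exact (M.losProb_measurable k s).const_sub 1

theorem linkProb_mem_Icc (c : Channel) {x : ℝ} (hx : M.gap s k ≤ x) :
    M.linkProb o s k c x ∈ Set.Icc (0 : ℝ) 1 := by
  have hsk := M.losProb_mem s k x hx
  have hks := M.losProb_mem k s x (by rwa [abs_sub_comm])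
  cases o <;> cases c
  exacts [hsk, Set.Icc.mem_iff_one_sub_mem.1 hsk, hks, Set.Icc.mem_iff_one_sub_mem.1 hks]

theorem sum_linkProb (x : ℝ) : ∑ c, M.linkProb o s k c x = 1 := by
  rw [show (Finset.univ : Finset Channel) = {.los, .nlos} from rfl, Finset.sum_pair (by simp)]
  cases o <;> exact add_sub_cancel _ _

/-- The probability that a `k`-layer node above `x` is farther away than the threshold `v (k, c)`,
where `c` is the random state of its link. -/
def beyondProb (v : Fin (K + 1) × Channel → ℝ) (x : Plane) : ℝ :=
  ∑ c, if v (k, c) < M.linkDist s u k x then M.linkProb o s k c (M.linkDist s u k x) else 0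

variable (v : Fin (K + 1) × Channel → ℝ)

theorem measurable_beyondProb : Measurable (M.beyondProb o s k u v) := by
  have hd := (M.continuous_linkDist s k u).measurable
  exact Finset.measurable_fun_sum _ fun c _ => Measurable.ite
    (measurableSet_lt measurable_const hd) ((M.measurable_linkProb o s k c).comp hd)
    measurable_const

theorem one_sub_beyondProb (x : Plane) : 1 - M.beyondProb o s k u v x =
    ∑ c, if M.linkDist s u k x ≤ v (k, c) then M.linkProb o s k c (M.linkDist s u k x) else 0 := by
  rw [← M.sum_linkProb o s k (M.linkDist s u k x), beyondProb, ← Finset.sum_sub_distrib]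
  refine Finset.sum_congr rfl fun c _ => ?_
  by_cases h : v (k, c) < M.linkDist s u k x
  · simp [h]
  · simp [h, not_lt.1 h]

theorem beyondProb_mem_Icc (x : Plane) : M.beyondProb o s k u v x ∈ Set.Icc (0 : ℝ) 1 := by
  have h := fun c => (M.linkProb_mem_Icc o s k c (M.gap_le_linkDist s k u x)).1
  refine ⟨Finset.sum_nonneg fun c _ => ite_nonneg (h c) le_rfl, sub_nonneg.1 ?_⟩
  rw [one_sub_beyondProb]
  exact Finset.sum_nonneg fun c _ => ite_nonneg (h c) le_rfl

theorem exists_forall_notMem_closedBall_beyondProb_eq_one :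
    ∃ R : ℝ, ∀ x ∉ Metric.closedBall u R, M.beyondProb o s k u v x = 1 := by
  refine ⟨∑ c, |v (k, c)|, fun x hx => ?_⟩
  rw [← M.sum_linkProb o s k (M.linkDist s u k x), beyondProb]
  refine Finset.sum_congr rfl fun c _ => if_pos ?_
  rw [Metric.mem_closedBall, not_le, dist_eq_norm] at hx
  calc v (k, c) ≤ |v (k, c)| := le_abs_self _
    _ ≤ ∑ c, |v (k, c)| :=
      Finset.single_le_sum (f := fun c => |v (k, c)|) (fun c _ => abs_nonneg _) (Finset.mem_univ c)
    _ < _ := hx.trans_le (M.norm_sub_le_linkDist s k u x)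

end Network

theorem measurableSet_filter_fiber {Ω α : Type*} {_ : MeasurableSpace Ω} [Countable α]
    {q : α → Ω → Prop} [∀ ω, DecidablePred (q · ω)] (hq : ∀ a, MeasurableSet {ω | q a ω})
    (T S : Finset α) : MeasurableSet ((fun ω => {a ∈ T | q a ω}) ⁻¹' {S}) := by
  have : (fun ω => {a ∈ T | q a ω}) ⁻¹' {S} = ⋂ a, {ω | a ∈ T ∧ q a ω ↔ a ∈ S} := by
    ext ω
    simp [Finset.ext_iff]
  rw [this]
  exact MeasurableSet.iInter fun a => measurableSet_setOfPred.2 <|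
    (measurable_const.and (measurableSet_setOfPred.1 (hq a))).iff measurable_const

theorem sum_measureReal_fiber_inter {Ω β : Type*} [MeasurableSpace Ω] {P : Measure Ω}
    [IsFiniteMeasure P] {X : Ω → β} {B : Finset β} (hXB : ∀ ω, X ω ∈ B)
    (hX : ∀ b, MeasurableSet (X ⁻¹' {b})) (E : Set Ω) :
    ∑ b ∈ B, P.real (X ⁻¹' {b} ∩ E) = P.real E := by
  simp_rw [← measureReal_restrict_apply (hX _)]
  rw [sum_measureReal_preimage_singleton B fun b _ => hX b, Set.preimage_eq_univ_iff.2
    (Set.range_subset_iff.2 hXB), measureReal_restrict_apply MeasurableSet.univ, Set.univ_inter]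

theorem sum_setIntegral_fiber {Ω β : Type*} [MeasurableSpace Ω] {P : Measure Ω}
    {X : Ω → β} {B : Finset β} (hXB : ∀ ω, X ω ∈ B) (hX : ∀ b, MeasurableSet (X ⁻¹' {b}))
    {f : Ω → ℝ} (hf : Integrable f P) :
    ∑ b ∈ B, ∫ ω in X ⁻¹' {b}, f ω ∂P = ∫ ω, f ω ∂P := by
  have huniv : ⋃ b ∈ B, X ⁻¹' {b} = Set.univ := by ext ω; simpa using hXB ω
  rw [← integral_biUnion_finset B (fun b _ => hX b)
    (fun b _ b' _ hne => (Set.disjoint_singleton.2 hne).preimage X) fun b _ => hf.integrableOn,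
    huniv, setIntegral_univ]

section Thinning

variable {K : ℕ} {Ω : Type*} [MeasurableSpace Ω] {M : Network K} {o : Subject}
  {s : Fin (K + 1)} {u : Plane} {P : Measure Ω} {Φ : Fin (K + 1) → RandomPoints Ω}
  {state : Fin (K + 1) × ℕ → Ω → Channel}

theorem iSup_sigma_le (Φ : Fin (K + 1) → RandomPoints Ω) :
    ⨆ k, (Φ k).sigma ≤ ‹MeasurableSpace Ω› :=
  iSup_le fun k => (Φ k).sigma_le

theorem measurable_pt_iSup_sigma (Φ : Fin (K + 1) → RandomPoints Ω) (p : Fin (K + 1) × ℕ) :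
    Measurable[⨆ k, (Φ k).sigma] ((Φ p.1).pt p.2) :=
  ((Φ p.1).measurable_pt_sigma p.2).mono (le_iSup (fun k => (Φ k).sigma) p.1) le_rfl

theorem measurable_nodeDist_iSup_sigma (M : Network K) (s : Fin (K + 1)) (u : Plane)
    (Φ : Fin (K + 1) → RandomPoints Ω) (p : Fin (K + 1) × ℕ) :
    Measurable[⨆ k, (Φ k).sigma] (nodeDist M s u Φ p) :=
  (M.continuous_linkDist s p.1 u).measurable.comp (measurable_pt_iSup_sigma Φ p)

theorem measurable_nodeDist (M : Network K) (s : Fin (K + 1)) (u : Plane)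
    (Φ : Fin (K + 1) → RandomPoints Ω) (p : Fin (K + 1) × ℕ) : Measurable (nodeDist M s u Φ p) :=
  (measurable_nodeDist_iSup_sigma M s u Φ p).mono (iSup_sigma_le Φ) le_rfl

theorem measurableSet_isNode_iSup_sigma (Φ : Fin (K + 1) → RandomPoints Ω)
    (p : Fin (K + 1) × ℕ) : MeasurableSet[⨆ k, (Φ k).sigma] {ω | IsNode Φ p ω} :=
  le_iSup (fun k => (Φ k).sigma) p.1 _ ((Φ p.1).measurableSet_lt_num_sigma p.2)

theorem measurableSet_isNode (Φ : Fin (K + 1) → RandomPoints Ω) (p : Fin (K + 1) × ℕ) :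
    MeasurableSet {ω | IsNode Φ p ω} :=
  iSup_sigma_le Φ _ (measurableSet_isNode_iSup_sigma Φ p)

theorem nodeDist_nonneg (p : Fin (K + 1) × ℕ) (ω : Ω) : 0 ≤ nodeDist M s u Φ p ω :=
  M.linkDist_nonneg _ _ _ _

theorem integrable_prod_mark_beyondProb [IsFiniteMeasure P] (v : Fin (K + 1) × Channel → ℝ)
    (S : Finset (Fin (K + 1) × ℕ)) :
    Integrable (fun ω => ∏ p ∈ S, (Φ p.1).mark (M.beyondProb o s p.1 u v) p.2 ω) P := by
  have hmem := fun (p : Fin (K + 1) × ℕ) ω => RandomPoints.mark_mem_Icc (Φ := Φ p.1) (ω := ω)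
    (M.beyondProb_mem_Icc o s p.1 u v) p.2
  exact Integrable.of_mem_Icc 0 1
    (Finset.measurable_fun_prod _ fun p _ => ((Φ p.1).measurable_mark_sigma
      (M.measurable_beyondProb o s p.1 u v) p.2).mono (Φ p.1).sigma_le le_rfl).aemeasurable
    (ae_of_all _ fun ω => ⟨Finset.prod_nonneg fun p _ => (hmem p ω).1,
      Finset.prod_le_one (fun p _ => (hmem p ω).1) fun p _ => (hmem p ω).2⟩)

namespace IsLinkState

variable [IsFiniteMeasure P]

theorem measureReal_inter_states (h : IsLinkState M o s u Φ state P)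
    (S : Finset (Fin (K + 1) × ℕ)) (γ : Fin (K + 1) × ℕ → Channel) {G : Set Ω}
    (hG : MeasurableSet[⨆ k, (Φ k).sigma] G) (hGS : ∀ ω ∈ G, ∀ p ∈ S, IsNode Φ p ω) :
    P.real (G ∩ {ω | ∀ p ∈ S, state p ω = γ p}) =
      ∫ ω in G, ∏ p ∈ S, M.linkProb o s p.1 (γ p) (nodeDist M s u Φ p ω) ∂P := by
  have hm : MeasurableSet {ω | ∀ p ∈ S, state p ω = γ p} := by
    simp only [Set.ofPred_forall]
    exact Finset.measurableSet_biInter _ fun p _ => h.measurable p _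
  rw [← setIntegral_congr_ae (f := P[Set.indicator {ω' | ∀ p ∈ S, state p ω' = γ p}
      (fun _ => (1 : ℝ)) | ⨆ k, (Φ k).sigma]) (iSup_sigma_le Φ _ hG)
      ((h.cond S γ).mono fun ω hω hωG => hω (hGS ω hωG)),
    setIntegral_condExp (iSup_sigma_le Φ) ((integrable_const _).indicator hm) hG,
    setIntegral_indicator hm, setIntegral_const, smul_eq_mul, mul_one]

theorem measureReal_states_eq_inter_forall_lt (h : IsLinkState M o s u Φ state P)
    (v : Fin (K + 1) × Channel → ℝ) (S : Finset (Fin (K + 1) × ℕ)) {G : Set Ω}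
    (hG : MeasurableSet[⨆ k, (Φ k).sigma] G) (hGS : ∀ ω ∈ G, ∀ p ∈ S, IsNode Φ p ω)
    (γ : S → Channel) :
    P.real ((fun ω (p : S) => state p ω) ⁻¹' {γ} ∩
        (G ∩ {ω | ∀ p ∈ S, v (p.1, state p ω) < nodeDist M s u Φ p ω})) =
      ∫ ω in G, ∏ p : S, (if v (p.1.1, γ p) < nodeDist M s u Φ p ω then
        M.linkProb o s p.1.1 (γ p) (nodeDist M s u Φ p ω) else 0) ∂P := by
  classical
  let γ' : Fin (K + 1) × ℕ → Channel := Function.extend Subtype.val γ fun _ => .los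
  have hγ' : ∀ p : S, γ p = γ' p := fun p => (Subtype.val_injective.extend_apply γ _ p).symm
  have hF : MeasurableSet[⨆ k, (Φ k).sigma]
      {ω | ∀ p ∈ S, v (p.1, γ' p) < nodeDist M s u Φ p ω} := by
    simp only [Set.ofPred_forall]
    exact Finset.measurableSet_biInter _ fun p _ =>
      measurableSet_lt measurable_const (measurable_nodeDist_iSup_sigma M s u Φ p)
  trans P.real (G ∩ {ω | ∀ p ∈ S, v (p.1, γ' p) < nodeDist M s u Φ p ω} ∩
    {ω | ∀ p ∈ S, state p ω = γ' p})
  · congr 1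
    ext ω
    simp only [Set.mem_inter_iff, Set.mem_preimage, Set.mem_singleton_iff, funext_iff, hγ',
      Subtype.forall, Set.mem_ofPred_eq]
    grind
  · rw [h.measureReal_inter_states S γ' (hG.inter hF) fun ω hω => hGS ω hω.1,
      ← setIntegral_indicator (iSup_sigma_le Φ _ hF)]
    congr 1 with ω
    simp only [hγ']
    rw [Finset.prod_coe_sort S fun p => if v (p.1, γ' p) < nodeDist M s u Φ p ω then
      M.linkProb o s p.1 (γ' p) (nodeDist M s u Φ p ω) else 0, Finset.prod_ite_zero,
      Set.indicator_apply]
    rfl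

theorem measureReal_inter_forall_lt (h : IsLinkState M o s u Φ state P)
    (v : Fin (K + 1) × Channel → ℝ) (S : Finset (Fin (K + 1) × ℕ)) {G : Set Ω}
    (hG : MeasurableSet[⨆ k, (Φ k).sigma] G) (hGS : ∀ ω ∈ G, ∀ p ∈ S, IsNode Φ p ω) :
    P.real (G ∩ {ω | ∀ p ∈ S, v (p.1, state p ω) < nodeDist M s u Φ p ω}) =
      ∫ ω in G, ∏ p ∈ S, M.beyondProb o s p.1 u v ((Φ p.1).pt p.2 ω) ∂P := by
  let w : Fin (K + 1) × ℕ → Channel → Ω → ℝ := fun p c ω =>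
    if v (p.1, c) < nodeDist M s u Φ p ω then M.linkProb o s p.1 c (nodeDist M s u Φ p ω) else 0
  have hw : ∀ γ : S → Channel, Integrable (fun ω => ∏ p : S, w p (γ p) ω) P := fun γ => by
    have hmem : ∀ p c ω, w p c ω ∈ Set.Icc 0 1 := fun p c ω => by
      have := M.linkProb_mem_Icc o s p.1 c (M.gap_le_linkDist s p.1 u ((Φ p.1).pt p.2 ω))
      simp only [w]
      split_ifs
      exacts [this, by simp]
    have hmeas : ∀ p c, Measurable (w p c) := fun p c =>
      have hd := measurable_nodeDist M s u Φ p
      Measurable.ite (measurableSet_lt measurable_const hd)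
        ((M.measurable_linkProb o s p.1 c).comp hd) measurable_const
    exact Integrable.of_mem_Icc 0 1 (Finset.measurable_fun_prod _ fun p _ => hmeas _ _).aemeasurable
      (ae_of_all _ fun ω => ⟨Finset.prod_nonneg fun p _ => (hmem _ _ _).1,
        Finset.prod_le_one (fun p _ => (hmem _ _ _).1) fun p _ => (hmem _ _ _).2⟩)
  have hX : ∀ γ, MeasurableSet ((fun ω (p : S) => state p ω) ⁻¹' {γ}) := fun γ => by
    have : (fun ω (p : S) => state p ω) ⁻¹' {γ} = ⋂ p : S, {ω | state p ω = γ p} := by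
      ext; simp [funext_iff]
    rw [this]
    exact MeasurableSet.iInter fun p => h.measurable p _
  rw [← sum_measureReal_fiber_inter (fun _ => Finset.mem_univ _) hX,
    Finset.sum_congr rfl fun γ _ => h.measureReal_states_eq_inter_forall_lt v S hG hGS γ,
    ← integral_finsetSum _ fun γ _ => (hw γ).integrableOn]
  congr 1 with ω
  rw [← Finset.prod_coe_sort, ← Fintype.piFinset_univ]
  exact (Finset.prod_univ_sum _ fun (p : S) c => w p c ω).symm

end IsLinkState

/-- If `p` is a node, it is farther away than the threshold `v` of its layer and link state. All
`p` have this property exactly when every nearest-node distance exceeds its threshold. -/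
def Beyond (M : Network K) (s : Fin (K + 1)) (u : Plane) (Φ : Fin (K + 1) → RandomPoints Ω)
    (state : Fin (K + 1) × ℕ → Ω → Channel) (v : Fin (K + 1) × Channel → ℝ)
    (p : Fin (K + 1) × ℕ) (ω : Ω) : Prop :=
  IsNode Φ p ω → v (p.1, state p ω) < nodeDist M s u Φ p ω

theorem IsLinkState.measureReal_forall_mem_beyond [IsFiniteMeasure P]
    (h : IsLinkState M o s u Φ state P) (v : Fin (K + 1) × Channel → ℝ)
    (T : Finset (Fin (K + 1) × ℕ)) :
    P.real {ω | ∀ p ∈ T, Beyond M s u Φ state v p ω} =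
      ∫ ω, ∏ p ∈ T, (Φ p.1).mark (M.beyondProb o s p.1 u v) p.2 ω ∂P := by
  classical
  let X : Ω → Finset (Fin (K + 1) × ℕ) := fun ω => {p ∈ T | IsNode Φ p ω}
  have hX : ∀ S, MeasurableSet[⨆ k, (Φ k).sigma] (X ⁻¹' {S}) := fun S =>
    measurableSet_filter_fiber (measurableSet_isNode_iSup_sigma Φ) T S
  have hXT : ∀ ω, X ω ∈ T.powerset := fun ω => Finset.mem_powerset.2 (Finset.filter_subset _ _)
  rw [← sum_measureReal_fiber_inter hXT fun S => iSup_sigma_le Φ _ (hX S),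
    ← sum_setIntegral_fiber hXT (fun S => iSup_sigma_le Φ _ (hX S))
      (integrable_prod_mark_beyondProb v T)]
  refine Finset.sum_congr rfl fun S _ => ?_
  trans P.real (X ⁻¹' {S} ∩ {ω | ∀ p ∈ S, v (p.1, state p ω) < nodeDist M s u Φ p ω})
  · congr 1
    ext ω
    simp only [X, Beyond, Set.mem_inter_iff, Set.mem_preimage, Set.mem_singleton_iff,
      Set.mem_ofPred_eq]
    refine and_congr_right ?_
    rintro rfl
    simp
  · rw [h.measureReal_inter_forall_lt v S (hX S)]
    · refine setIntegral_congr_fun (iSup_sigma_le Φ _ (hX S)) ?_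
      rintro ω rfl
      refine (Finset.prod_filter _ _).trans ?_
      exact Finset.prod_congr rfl fun p _ => by unfold RandomPoints.mark IsNode; congr
    · rintro ω rfl p hp
      exact (Finset.mem_filter.1 hp).2

end Thinning

theorem Ioc_max_left_eq {α : Type*} [LinearOrder α] (a b : α) :
    Set.Ioc a (max b a) = Set.Ioc a b := by
  rcases le_total a b with h | h
  · rw [max_eq_left h]
  · rw [max_eq_right h, Set.Ioc_self, Set.Ioc_eq_empty h.not_gt]

namespace Network

variable {K : ℕ} (M : Network K) (o : Subject) (s k : Fin (K + 1)) (u : Plane) (c : Channel)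

theorem integral_comp_linkDist (f : ℝ → ℝ) :
    ∫ x, f (M.linkDist s u k x) = 2 * Real.pi * ∫ r in Set.Ioi (M.gap s k), r * f r := by
  have hball : volume.real (Metric.ball (0 : Plane) 1) = Real.pi := by
    rw [measureReal_def, EuclideanSpace.volume_ball, Fintype.card_fin, Real.sq_sqrt Real.pi_pos.le]
    norm_num [Real.Gamma_two, Real.pi_pos.le]
  simp_rw [linkDist_eq_sqrt]
  rw [integral_sub_right_eq_self (fun x : Plane => f √(‖x‖ ^ 2 + M.gap s k ^ 2)) u,
    integral_fun_norm_addHaar volume (fun y => f √(y ^ 2 + M.gap s k ^ 2)),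
    ← integral_Ioi_comp_sqrt (M.gap_nonneg s k), hball, finrank_euclideanSpace_fin]
  simp only [Nat.add_one_sub_one, pow_one, smul_eq_mul, nsmul_eq_mul, Nat.cast_ofNat, mul_assoc]

/-- The intensity at `x` of the point process of the distances from the selecting node to the
`k`-layer candidates whose links are in state `c`. -/
def intensity (x : ℝ) : ℝ :=
  2 * Real.pi * (M.density o.candidates k : ℝ) * x * M.linkProb o s k c x

theorem measurable_intensity : Measurable (M.intensity o s k c) :=
  (measurable_id.const_mul _).mul (M.measurable_linkProb o s k c)

theorem intensity_nonneg {x : ℝ} (hx : M.gap s k ≤ x) : 0 ≤ M.intensity o s k c x := by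
  have := (M.gap_nonneg s k).trans hx
  exact mul_nonneg (by positivity) (M.linkProb_mem_Icc o s k c hx).1

theorem intervalIntegrable_intensity {b : ℝ} (hb : M.gap s k ≤ b) :
    IntervalIntegrable (M.intensity o s k c) volume (M.gap s k) b := by
  rw [intervalIntegrable_iff_integrableOn_Icc_of_le hb]
  refine IntegrableOn.of_bound measure_Icc_lt_top
    (M.measurable_intensity o s k c).aestronglyMeasurable
    (2 * Real.pi * (M.density o.candidates k : ℝ) * b)
    ((ae_restrict_iff' measurableSet_Icc).2 (ae_of_all _ fun x hx => ?_))
  have hx0 : 0 ≤ x := (M.gap_nonneg s k).trans hx.1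
  rw [Real.norm_of_nonneg (M.intensity_nonneg o s k c hx.1)]
  exact (mul_le_of_le_one_right (by positivity) (M.linkProb_mem_Icc o s k c hx.1).2).trans
    (mul_le_mul_of_nonneg_left hx.2 (by positivity))

theorem nearestCCDF_eq (v : ℝ) : M.nearestCCDF o s k c v =
    Real.exp (-∫ x in (M.gap s k)..(max v (M.gap s k)), M.intensity o s k c x) := rfl

theorem nearestCCDF_nonneg (v : ℝ) : 0 ≤ M.nearestCCDF o s k c v := (Real.exp_pos _).le

theorem nearestCCDF_of_le_gap {v : ℝ} (hv : v ≤ M.gap s k) : M.nearestCCDF o s k c v = 1 := by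
  rw [nearestCCDF_eq, max_eq_right hv, intervalIntegral.integral_same, neg_zero, Real.exp_zero]

theorem antitone_nearestCCDF : Antitone (M.nearestCCDF o s k c) := fun v w hvw => by
  rw [nearestCCDF_eq, nearestCCDF_eq, Real.exp_le_exp, neg_le_neg_iff]
  refine intervalIntegral.integral_mono_interval le_rfl (le_max_right _ _)
    (max_le_max_right _ hvw) ?_ (M.intervalIntegrable_intensity o s k c (le_max_right _ _))
  exact (ae_restrict_iff' measurableSet_Ioc).2 (ae_of_all _ fun x hx =>
    M.intensity_nonneg o s k c hx.1.le)

theorem measurable_nearestCCDF : Measurable (M.nearestCCDF o s k c) :=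
  (M.antitone_nearestCCDF o s k c).measurable

theorem nearestCCDF_le_one (v : ℝ) : M.nearestCCDF o s k c v ≤ 1 :=
  (M.antitone_nearestCCDF o s k c (min_le_left v (M.gap s k))).trans
    (M.nearestCCDF_of_le_gap o s k c (min_le_right _ _)).le

theorem nearestPDF_eq_indicator : M.nearestPDF o s k c =
    (Set.Ici (M.gap s k)).indicator fun v => M.intensity o s k c v * M.nearestCCDF o s k c v := by
  ext v
  rw [nearestPDF, Set.indicator_apply, nearestCCDF]
  by_cases h : v < M.gap s k
  · rw [if_pos h, if_neg (Set.notMem_Ici.2 h)]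
  · rw [if_neg h, if_pos (Set.mem_Ici.2 (not_lt.1 h)), max_eq_left (not_lt.1 h), intensity]

theorem measurable_nearestPDF : Measurable (M.nearestPDF o s k c) := by
  rw [nearestPDF_eq_indicator]
  exact ((M.measurable_intensity o s k c).mul (M.measurable_nearestCCDF o s k c)).indicator
    measurableSet_Ici

theorem nearestPDF_nonneg (v : ℝ) : 0 ≤ M.nearestPDF o s k c v := by
  rw [nearestPDF_eq_indicator]
  exact Set.indicator_nonneg (fun v hv =>
    mul_nonneg (M.intensity_nonneg o s k c hv) (M.nearestCCDF_nonneg o s k c v)) v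

theorem intervalIntegrable_nearestPDF {v : ℝ} (hv : M.gap s k ≤ v) :
    IntervalIntegrable (M.nearestPDF o s k c) volume (M.gap s k) v := by
  refine (M.intervalIntegrable_intensity o s k c hv).mono_fun
    (M.measurable_nearestPDF o s k c).aestronglyMeasurable (ae_of_all _ fun x => ?_)
  rw [nearestPDF_eq_indicator]
  refine (norm_indicator_le_norm_self _ x).trans ?_
  rw [norm_mul, Real.norm_of_nonneg (M.nearestCCDF_nonneg o s k c x)]
  exact mul_le_of_le_one_right (norm_nonneg _) (M.nearestCCDF_le_one o s k c x)

theorem integral_nearestPDF {v : ℝ} (hv : M.gap s k ≤ v) :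
    ∫ x in (M.gap s k)..v, M.nearestPDF o s k c x = 1 - M.nearestCCDF o s k c v := by
  rw [nearestCCDF_eq, max_eq_left hv,
    ← intervalIntegral_mul_exp_neg (M.intervalIntegrable_intensity o s k c hv)]
  refine intervalIntegral.integral_congr fun x hx => ?_
  rw [Set.uIcc_of_le hv] at hx
  simp only [nearestPDF_eq_indicator, Set.indicator_of_mem (Set.mem_Ici.2 hx.1), nearestCCDF_eq,
    max_eq_left hx.1]

theorem setLIntegral_nearestPDF_Iic (v : ℝ) :
    ∫⁻ x in Set.Iic v, ENNReal.ofReal (M.nearestPDF o s k c x) =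
      ENNReal.ofReal (1 - M.nearestCCDF o s k c v) := by
  have hIoc : ∫⁻ x in Set.Iic v, ENNReal.ofReal (M.nearestPDF o s k c x) =
      ∫⁻ x in Set.Ioc (M.gap s k) v, ENNReal.ofReal (M.nearestPDF o s k c x) := by
    rw [Measure.restrict_congr_set Ioc_ae_eq_Icc, ← Set.Ici_inter_Iic,
      ← setLIntegral_indicator measurableSet_Ici]
    congr 1 with x
    simp only [nearestPDF_eq_indicator, Set.indicator_apply]
    split_ifs <;> simp
  rw [hIoc]
  rcases lt_or_ge v (M.gap s k) with hv | hv
  · rw [Set.Ioc_eq_empty hv.not_gt, M.nearestCCDF_of_le_gap o s k c hv.le]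
    simp
  · rw [← M.integral_nearestPDF o s k c hv, intervalIntegral.integral_of_le hv,
      ofReal_integral_eq_lintegral_ofReal (M.intervalIntegrable_nearestPDF o s k c hv).1
        (ae_of_all _ (M.nearestPDF_nonneg o s k c))]

theorem density_mul_integral_one_sub_beyondProb (v : Fin (K + 1) × Channel → ℝ) :
    (M.density o.candidates k : ℝ) * ∫ x, (1 - M.beyondProb o s k u v x) =
      ∑ c, ∫ x in (M.gap s k)..(max (v (k, c)) (M.gap s k)), M.intensity o s k c x := by
  have hint : ∀ c, IntegrableOn ((Set.Iic (v (k, c))).indicator (M.intensity o s k c))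
      (Set.Ioi (M.gap s k)) := fun c => by
    rw [IntegrableOn, integrable_indicator_iff measurableSet_Iic, IntegrableOn,
      Measure.restrict_restrict measurableSet_Iic, Set.inter_comm, Set.Ioi_inter_Iic,
      ← Ioc_max_left_eq]
    exact (M.intervalIntegrable_intensity o s k c (le_max_right _ _)).1
  calc (M.density o.candidates k : ℝ) * ∫ x, (1 - M.beyondProb o s k u v x)
      = ∫ x in Set.Ioi (M.gap s k),
          ∑ c, (Set.Iic (v (k, c))).indicator (M.intensity o s k c) x := by
        simp_rw [one_sub_beyondProb]
        rw [M.integral_comp_linkDist s k u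
          (fun d => ∑ c, if d ≤ v (k, c) then M.linkProb o s k c d else 0), ← integral_const_mul,
          ← integral_const_mul]
        congr 1 with x
        simp only [Finset.mul_sum, Set.indicator_apply, Set.mem_Iic, intensity]
        refine Finset.sum_congr rfl fun c _ => ?_
        split_ifs <;> ring
    _ = ∑ c, ∫ x in (M.gap s k)..(max (v (k, c)) (M.gap s k)), M.intensity o s k c x := by
        rw [integral_finsetSum _ fun c _ => hint c]
        refine Finset.sum_congr rfl fun c _ => ?_
        rw [setIntegral_indicator measurableSet_Iic, Set.Ioi_inter_Iic, ← Ioc_max_left_eq,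
          intervalIntegral.integral_of_le (le_max_right _ _)]

theorem exp_neg_density_mul_integral_one_sub_beyondProb (v : Fin (K + 1) × Channel → ℝ) :
    Real.exp (-(M.density o.candidates k * ∫ x, (1 - M.beyondProb o s k u v x))) =
      ∏ c, M.nearestCCDF o s k c (v (k, c)) := by
  rw [density_mul_integral_one_sub_beyondProb, ← Finset.sum_neg_distrib, Real.exp_sum]
  rfl

end Network

/-- The probabilistic model: the candidates of the different layers form independent homogeneous
Poisson processes, and `state` gives the states of their links to the selecting node. It bundles
what is known about `Φ` and `state`, so that lemmas can refer to it as a whole. -/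
structure IsPoissonNetwork {K : ℕ} {Ω : Type*} [MeasurableSpace Ω] (M : Network K) (o : Subject)
    (s : Fin (K + 1)) (u : Plane) (Φ : Fin (K + 1) → RandomPoints Ω)
    (state : Fin (K + 1) × ℕ → Ω → Channel) (P : Measure Ω) : Prop where
  isPoisson : ∀ k, (Φ k).IsPoisson P (M.density o.candidates k)
  iIndep_sigma : iIndep (fun k => (Φ k).sigma) P
  isLinkState : IsLinkState M o s u Φ state P

section Void

variable {K : ℕ} {Ω : Type*} [MeasurableSpace Ω] {M : Network K} {o : Subject}
  {s : Fin (K + 1)} {u : Plane} {P : Measure Ω} {Φ : Fin (K + 1) → RandomPoints Ω}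
  {state : Fin (K + 1) × ℕ → Ω → Channel}

theorem IsLinkState.measurableSet_beyond (h : IsLinkState M o s u Φ state P)
    (v : Fin (K + 1) × Channel → ℝ) (p : Fin (K + 1) × ℕ) :
    MeasurableSet {ω | Beyond M s u Φ state v p ω} := by
  have : {ω | Beyond M s u Φ state v p ω} = {ω | IsNode Φ p ω}ᶜ ∪
      ⋃ c, {ω | state p ω = c} ∩ {ω | v (p.1, c) < nodeDist M s u Φ p ω} := by
    ext ω
    simp [Beyond, imp_iff_not_or]
  rw [this]
  exact (measurableSet_isNode Φ p).compl.union (MeasurableSet.iUnion fun c =>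
    (h.measurable p c).inter (measurableSet_lt measurable_const (measurable_nodeDist M s u Φ p)))

theorem integral_prod_mark_beyondProb (hindep : iIndep (fun k => (Φ k).sigma) P)
    (v : Fin (K + 1) × Channel → ℝ) (N : ℕ) :
    ∫ ω, ∏ p ∈ (Finset.univ : Finset (Fin (K + 1))) ×ˢ Finset.range N,
        (Φ p.1).mark (M.beyondProb o s p.1 u v) p.2 ω ∂P =
      ∏ k, ∫ ω, ∏ n ∈ Finset.range N, (Φ k).mark (M.beyondProb o s k u v) n ω ∂P := by
  have hmeas : ∀ k, Measurable[(Φ k).sigma] fun ω =>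
      ∏ n ∈ Finset.range N, (Φ k).mark (M.beyondProb o s k u v) n ω := fun k =>
    Finset.measurable_fun_prod _ fun n _ =>
      (Φ k).measurable_mark_sigma (M.measurable_beyondProb o s k u v) n
  simp_rw [Finset.prod_product]
  exact iIndepFun.integral_fun_prod_eq_prod_integral ((iIndepFun_iff_iIndep _ _ _).2
    (iIndep_of_iIndep_of_le hindep fun k => (hmeas k).comap_le))
    fun k => ((hmeas k).mono (Φ k).sigma_le le_rfl).aestronglyMeasurable

theorem IsLinkState.tendsto_measureReal_beyond [IsFiniteMeasure P]
    (h : IsLinkState M o s u Φ state P) (v : Fin (K + 1) × Channel → ℝ) :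
    Tendsto (fun N => P.real {ω | ∀ p ∈ (Finset.univ : Finset (Fin (K + 1))) ×ˢ Finset.range N,
        Beyond M s u Φ state v p ω}) atTop
      (𝓝 (P.real {ω | ∀ p, Beyond M s u Φ state v p ω})) := by
  have hmeas : ∀ N, MeasurableSet {ω | ∀ p ∈ (Finset.univ : Finset (Fin (K + 1))) ×ˢ
      Finset.range N, Beyond M s u Φ state v p ω} := fun N => by
    simp only [Set.ofPred_forall]
    exact Finset.measurableSet_biInter _ fun p _ => h.measurableSet_beyond v p
  have hinter : ⋂ N, {ω | ∀ p ∈ (Finset.univ : Finset (Fin (K + 1))) ×ˢ Finset.range N,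
      Beyond M s u Φ state v p ω} = {ω | ∀ p, Beyond M s u Φ state v p ω} := by
    ext ω
    simp only [Set.mem_iInter, Set.mem_ofPred_eq]
    exact ⟨fun hω p => hω (p.2 + 1) p (by simp), fun hω N p _ => hω p⟩
  rw [← hinter]
  refine (ENNReal.tendsto_toReal (measure_ne_top P _)).comp
    (tendsto_measure_iInter_atTop (fun N => (hmeas N).nullMeasurableSet) ?_
      ⟨0, measure_ne_top P _⟩)
  exact fun N N' hN ω hω p hp =>
    hω p (Finset.product_subset_product_right (Finset.range_mono hN) hp)

theorem IsPoissonNetwork.measureReal_forall_beyond [IsProbabilityMeasure P]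
    (h : IsPoissonNetwork M o s u Φ state P) (v : Fin (K + 1) × Channel → ℝ) :
    P.real {ω | ∀ p, Beyond M s u Φ state v p ω} = ∏ p, M.nearestCCDF o s p.1 p.2 (v p) := by
  refine tendsto_nhds_unique (h.isLinkState.tendsto_measureReal_beyond v) ?_
  simp_rw [h.isLinkState.measureReal_forall_mem_beyond,
    integral_prod_mark_beyondProb h.iIndep_sigma, Fintype.prod_prod_type,
    ← M.exp_neg_density_mul_integral_one_sub_beyondProb o s _ u v]
  refine tendsto_finsetProd _ fun k _ => ?_
  obtain ⟨R, hR⟩ := M.exists_forall_notMem_closedBall_beyondProb_eq_one o s k u v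
  exact (h.isPoisson k).tendsto_integral_prod_mark Metric.isClosed_closedBall.measurableSet
    measure_closedBall_lt_top.ne (M.measurable_beyondProb o s k u v)
    (M.beyondProb_mem_Icc o s k u v) hR

end Void

/-- The extended nonnegative numbers that exceed the real number `v`. These sets generate the Borel
sets, so they carry the laws of the nearest-node distances; a real `v` is allowed to be negative,
which is why the comparison takes place in `EReal`. -/
def exceeding (v : ℝ) : Set ℝ≥0∞ := {x | (v : EReal) < (x : EReal)}

theorem mem_exceeding_iff_of_nonneg {v : ℝ} (hv : 0 ≤ v) {x : ℝ≥0∞} :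
    x ∈ exceeding v ↔ ENNReal.ofReal v < x := by
  rw [← EReal.coe_ennreal_lt_coe_ennreal_iff, EReal.coe_ennreal_ofReal, max_eq_left hv]
  rfl

theorem ofReal_mem_exceeding_iff {v d : ℝ} (hd : 0 ≤ d) :
    ENNReal.ofReal d ∈ exceeding v ↔ v < d := by
  rw [exceeding, Set.mem_ofPred_eq, EReal.coe_ennreal_ofReal, max_eq_left hd, EReal.coe_lt_coe_iff]

theorem isUpperSet_exceeding (v : ℝ) : IsUpperSet (exceeding v) := fun _ _ hxy hx =>
  lt_of_lt_of_le hx (EReal.coe_ennreal_le_coe_ennreal_iff.2 hxy)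

theorem notMem_exceeding_iff {v : ℝ} {x : ℝ≥0∞} :
    x ∉ exceeding v ↔ x ≠ ∞ ∧ x.toReal ≤ v := by
  rw [exceeding, Set.mem_ofPred_eq]
  induction x with
  | top => simp
  | coe r =>
    have : ((r : ℝ≥0∞) : EReal) = ((r : ℝ) : EReal) := rfl
    rw [this, EReal.coe_lt_coe_iff]
    simp

theorem exceeding_inter (v w : ℝ) : exceeding v ∩ exceeding w = exceeding (max v w) := by
  ext x
  simp only [exceeding, Set.mem_inter_iff, Set.mem_ofPred_eq,
    EReal.coe_strictMono.monotone.map_max, max_lt_iff]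

theorem exceeding_of_neg {v : ℝ} (hv : v < 0) : exceeding v = Set.univ :=
  Set.eq_univ_of_forall fun x =>
    (EReal.coe_lt_coe_iff.2 hv : (v : EReal) < (0 : ℝ)).trans_le (EReal.coe_ennreal_nonneg x)

theorem measurableSet_exceeding (v : ℝ) : MeasurableSet (exceeding v) :=
  measurableSet_lt measurable_const measurable_coe_ennreal_ereal

theorem measurableSpace_eq_generateFrom_exceeding :
    ENNReal.measurableSpace =
      MeasurableSpace.generateFrom (Set.range exceeding) := by
  refine le_antisymm ?_ (MeasurableSpace.generateFrom_le ?_)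
  · rw [BorelSpace.measurable_eq (α := ℝ≥0∞), borel_eq_generateFrom_Ioi]
    refine MeasurableSpace.generateFrom_le ?_
    rintro _ ⟨a, rfl⟩
    induction a with
    | top => simp
    | coe r =>
      refine MeasurableSpace.measurableSet_generateFrom ⟨r, ?_⟩
      ext x
      change (((r : ℝ≥0∞) : EReal) < (x : EReal)) ↔ _
      rw [EReal.coe_ennreal_lt_coe_ennreal_iff, Set.mem_Ioi]
  · rintro _ ⟨v, rfl⟩
    exact measurableSet_exceeding v

theorem iIndepFun_of_measure_biInter_exceeding {Ω ι : Type*} [MeasurableSpace Ω] {P : Measure Ω}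
    {V : ι → Ω → ℝ≥0∞} (hV : ∀ p, Measurable (V p))
    (h : ∀ (S : Finset ι) (v : ι → ℝ),
      P (⋂ p ∈ S, V p ⁻¹' exceeding (v p)) = ∏ p ∈ S, P (V p ⁻¹' exceeding (v p))) :
    iIndepFun V P := by
  rw [iIndepFun_iff_iIndep]
  refine iIndepSets.iIndep (fun p => (hV p).comap_le)
    (fun p => {A | ∃ v, V p ⁻¹' exceeding v = A}) (fun p => ?_) (fun p => ?_) ?_
  · rintro _ ⟨v, rfl⟩ _ ⟨w, rfl⟩ _
    exact ⟨max v w, by rw [← exceeding_inter, Set.preimage_inter]⟩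
  · rw [measurableSpace_eq_generateFrom_exceeding, MeasurableSpace.comap_generateFrom,
      ← Set.range_comp]
    rfl
  · rw [iIndepSets_iff]
    intro S f hf
    choose! v hv using hf
    rw [Finset.prod_congr rfl fun p hp => by rw [← hv p hp], ← h S v]
    exact congrArg P (Set.iInter₂_congr fun p hp => (hv p hp).symm)

section Nearest

variable {K : ℕ} {Ω : Type*} [MeasurableSpace Ω] {M : Network K} {o : Subject}
  {s : Fin (K + 1)} {u : Plane} {P : Measure Ω} {Φ : Fin (K + 1) → RandomPoints Ω}
  {state : Fin (K + 1) × ℕ → Ω → Channel}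

theorem IsLinkState.measurable_nearestDist (h : IsLinkState M o s u Φ state P)
    (k : Fin (K + 1)) (c : Channel) : Measurable (nearestDist M s u Φ state k c) := by
  classical
  have : nearestDist M s u Φ state k c = fun ω => ⨅ n : ℕ,
      if IsNode Φ (k, n) ω ∧ state (k, n) ω = c then
        ENNReal.ofReal (nodeDist M s u Φ (k, n) ω) else ∞ := by
    ext ω
    refine iInf_congr fun n => ?_
    split_ifs with hn <;> simp [hn]
  rw [this]
  exact Measurable.iInf fun n => Measurable.ite
    ((measurableSet_isNode Φ (k, n)).inter (h.measurable (k, n) c))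
    (measurable_nodeDist M s u Φ (k, n)).ennreal_ofReal measurable_const

/-- Only finitely many nodes lie within any given distance, so that nearest nodes exist. Integer
distances suffice, which leaves countably many conditions. -/
def LocallyFinite (M : Network K) (s : Fin (K + 1)) (u : Plane)
    (Φ : Fin (K + 1) → RandomPoints Ω) (ω : Ω) : Prop :=
  ∀ (k : Fin (K + 1)) (m : ℕ), {n : ℕ | IsNode Φ (k, n) ω ∧ nodeDist M s u Φ (k, n) ω ≤ m}.Finite

theorem ae_locallyFinite [IsProbabilityMeasure P] {lam : Fin (K + 1) → ℝ≥0}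
    (hΦ : ∀ k, (Φ k).IsPoisson P (lam k)) :
    ∀ᵐ ω ∂P, LocallyFinite M s u Φ ω := by
  refine ae_all_iff.2 fun k => ae_all_iff.2 fun m => ?_
  filter_upwards [(hΦ k).ae_count_ne_top
    (Metric.isClosed_closedBall (x := u) (ε := m)).measurableSet measure_closedBall_lt_top.ne]
    with ω hω
  refine (Set.encard_ne_top_iff.1 hω).subset fun n hn => ⟨hn.1, ?_⟩
  rw [Metric.mem_closedBall, dist_eq_norm]
  exact (M.norm_sub_le_linkDist s k u _).trans hn.2

theorem nearestDist_le {p : Fin (K + 1) × ℕ} {ω : Ω} (hp : IsNode Φ p ω) :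
    nearestDist M s u Φ state p.1 (state p ω) ω ≤ ENNReal.ofReal (nodeDist M s u Φ p ω) :=
  iInf₂_le p.2 ⟨hp, rfl⟩

theorem LocallyFinite.exists_eq_nearestDist {ω : Ω} (h : LocallyFinite M s u Φ ω)
    {k : Fin (K + 1)} {c : Channel} (hV : nearestDist M s u Φ state k c ω ≠ ∞) :
    ∃ n, IsNode Φ (k, n) ω ∧ state (k, n) ω = c ∧
      nearestDist M s u Φ state k c ω = ENNReal.ofReal (nodeDist M s u Φ (k, n) ω) := by
  have hex : ∃ n, IsNode Φ (k, n) ω ∧ state (k, n) ω = c := by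
    by_contra! hno
    exact hV (iInf₂_eq_top.2 fun n hn => absurd hn.2 (hno n hn.1))
  obtain ⟨n₀, hn₀, hc₀⟩ := hex
  obtain ⟨m, hm⟩ := exists_nat_ge (nodeDist M s u Φ (k, n₀) ω)
  have hfin : {n : ℕ | (IsNode Φ (k, n) ω ∧ nodeDist M s u Φ (k, n) ω ≤ m) ∧
      state (k, n) ω = c}.Finite := (h k m).subset fun n hn => hn.1
  obtain ⟨n, hn, hmin⟩ := Set.exists_min_image _ (fun n => nodeDist M s u Φ (k, n) ω) hfin
    ⟨n₀, ⟨hn₀, hm⟩, hc₀⟩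
  refine ⟨n, hn.1.1, hn.2, le_antisymm (iInf₂_le n ⟨hn.1.1, hn.2⟩) (le_iInf₂ fun n' hn' => ?_)⟩
  refine ENNReal.ofReal_le_ofReal ?_
  by_cases h' : nodeDist M s u Φ (k, n') ω ≤ m
  · exact hmin n' ⟨⟨hn'.1, h'⟩, hn'.2⟩
  · exact hn.1.2.trans (not_le.1 h').le

theorem LocallyFinite.forall_exceeding_iff {ω : Ω} (h : LocallyFinite M s u Φ ω)
    (v : Fin (K + 1) × Channel → ℝ) :
    (∀ p, nearestDist M s u Φ state p.1 p.2 ω ∈ exceeding (v p)) ↔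
      ∀ q, Beyond M s u Φ state v q ω := by
  constructor
  · intro hv q hq
    exact (ofReal_mem_exceeding_iff (nodeDist_nonneg q ω)).1
      (isUpperSet_exceeding _ (nearestDist_le hq) (hv (q.1, state q ω)))
  · rintro hv ⟨k, c⟩
    by_cases hV : nearestDist M s u Φ state k c ω = ∞
    · rw [hV]
      exact EReal.coe_lt_top _
    · obtain ⟨n, hn, rfl, hd⟩ := h.exists_eq_nearestDist hV
      rw [hd]
      exact (ofReal_mem_exceeding_iff (nodeDist_nonneg _ ω)).2 (hv (k, n) hn)

variable [IsProbabilityMeasure P]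

namespace IsPoissonNetwork

theorem measure_forall_exceeding (h : IsPoissonNetwork M o s u Φ state P)
    (v : Fin (K + 1) × Channel → ℝ) :
    P {ω | ∀ p, nearestDist M s u Φ state p.1 p.2 ω ∈ exceeding (v p)} =
      ∏ p, ENNReal.ofReal (M.nearestCCDF o s p.1 p.2 (v p)) := by
  have hae : {ω | ∀ p, nearestDist M s u Φ state p.1 p.2 ω ∈ exceeding (v p)} =ᵐ[P]
      {ω | ∀ q, Beyond M s u Φ state v q ω} := by
    filter_upwards [ae_locallyFinite h.isPoisson] with ω hω
    exact propext (hω.forall_exceeding_iff v)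
  rw [measure_congr hae, ← ENNReal.ofReal_prod_of_nonneg
    fun p _ => M.nearestCCDF_nonneg o s p.1 p.2 (v p), ← ofReal_measureReal,
    h.measureReal_forall_beyond v]

theorem measure_biInter_exceeding (h : IsPoissonNetwork M o s u Φ state P)
    (S : Finset (Fin (K + 1) × Channel)) (v : Fin (K + 1) × Channel → ℝ) :
    P (⋂ p ∈ S, nearestDist M s u Φ state p.1 p.2 ⁻¹' exceeding (v p)) =
      ∏ p ∈ S, ENNReal.ofReal (M.nearestCCDF o s p.1 p.2 (v p)) := by
  convert h.measure_forall_exceeding fun p => if p ∈ S then v p else -1 using 1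
  · congr 1
    ext ω
    simp only [Set.mem_iInter, Set.mem_preimage, Set.mem_ofPred_eq]
    refine forall_congr' fun p => ?_
    split_ifs with hp
    · simp [hp]
    · simp [hp, exceeding_of_neg]
  · rw [← Finset.prod_subset (Finset.subset_univ S)]
    · exact Finset.prod_congr rfl fun p hp => by rw [if_pos hp]
    · intro p _ hp
      rw [if_neg hp, M.nearestCCDF_of_le_gap o s p.1 p.2
        (neg_one_lt_zero.le.trans (M.gap_nonneg s p.1)), ENNReal.ofReal_one]

theorem measure_exceeding (h : IsPoissonNetwork M o s u Φ state P)
    (p : Fin (K + 1) × Channel) (v : ℝ) :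
    P (nearestDist M s u Φ state p.1 p.2 ⁻¹' exceeding v) =
      ENNReal.ofReal (M.nearestCCDF o s p.1 p.2 v) := by
  simpa using h.measure_biInter_exceeding {p} fun _ => v

theorem iIndepFun_nearestDist (h : IsPoissonNetwork M o s u Φ state P) :
    iIndepFun (fun (p : Fin (K + 1) × Channel) => nearestDist M s u Φ state p.1 p.2) P := by
  refine iIndepFun_of_measure_biInter_exceeding
    (fun p => h.isLinkState.measurable_nearestDist p.1 p.2) fun S v => ?_
  rw [h.measure_biInter_exceeding S v]
  exact Finset.prod_congr rfl fun p _ => (h.measure_exceeding p (v p)).symm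

theorem map_toReal_nearestDist (h : IsPoissonNetwork M o s u Φ state P)
    (k : Fin (K + 1)) (c : Channel) :
    (P.restrict {ω | nearestDist M s u Φ state k c ω ≠ ∞}).map
        (fun ω => (nearestDist M s u Φ state k c ω).toReal) =
      volume.withDensity fun v => ENNReal.ofReal (M.nearestPDF o s k c v) := by
  have hV := h.isLinkState.measurable_nearestDist k c
  refine Measure.ext_of_Iic _ _ fun v => ?_
  have hcompl : {ω | nearestDist M s u Φ state k c ω ≠ ∞ ∧
      (nearestDist M s u Φ state k c ω).toReal ≤ v} =
      (nearestDist M s u Φ state k c ⁻¹' exceeding v)ᶜ :=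
    Set.ext fun ω => notMem_exceeding_iff.symm
  rw [Measure.map_apply hV.ennreal_toReal measurableSet_Iic,
    Measure.restrict_apply (hV.ennreal_toReal measurableSet_Iic), Set.inter_comm,
    withDensity_apply _ measurableSet_Iic, M.setLIntegral_nearestPDF_Iic]
  refine (congrArg P hcompl).trans ?_
  rw [prob_compl_eq_one_sub (hV (measurableSet_exceeding v)),
    h.measure_exceeding (k, c) v, ENNReal.ofReal_sub _ (M.nearestCCDF_nonneg o s k c v),
    ENNReal.ofReal_one]

theorem measure_nearestDist_mem (h : IsPoissonNetwork M o s u Φ state P)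
    (k : Fin (K + 1)) (c : Channel) {B : Set ℝ} (hB : MeasurableSet B) :
    P {ω | nearestDist M s u Φ state k c ω ≠ ∞ ∧
        (nearestDist M s u Φ state k c ω).toReal ∈ B} =
      ∫⁻ v in B, ENNReal.ofReal (M.nearestPDF o s k c v) := by
  have hV := h.isLinkState.measurable_nearestDist k c
  rw [← withDensity_apply _ hB, ← h.map_toReal_nearestDist,
    Measure.map_apply hV.ennreal_toReal hB,
    Measure.restrict_apply (hV.ennreal_toReal hB), Set.inter_comm]
  rfl

theorem measure_nearestDist_eq_ofReal (h : IsPoissonNetwork M o s u Φ state P)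
    (k : Fin (K + 1)) (c : Channel) (r : ℝ) :
    P (nearestDist M s u Φ state k c ⁻¹' {ENNReal.ofReal r}) = 0 := by
  have h0 := h.measure_nearestDist_mem k c (measurableSet_singleton (ENNReal.ofReal r).toReal)
  rw [Measure.restrict_eq_zero.2 (measure_singleton _), lintegral_zero_measure] at h0
  refine measure_mono_null (fun ω hω => ?_) h0
  have hω' : nearestDist M s u Φ state k c ω = ENNReal.ofReal r := hω
  simp [hω']

theorem setLIntegral_comp_toReal_map_nearestDist (h : IsPoissonNetwork M o s u Φ state P)
    (k : Fin (K + 1)) (c : Channel) {g : ℝ → ℝ≥0∞} (hg : Measurable g) {B : Set ℝ}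
    (hB : MeasurableSet B) :
    ∫⁻ x in {x | x ≠ ∞ ∧ x.toReal ∈ B}, g x.toReal ∂(P.map (nearestDist M s u Φ state k c)) =
      ∫⁻ y in B, ENNReal.ofReal (M.nearestPDF o s k c y) * g y := by
  have hV := h.isLinkState.measurable_nearestDist k c
  have hg' : Measurable fun x : ℝ≥0∞ => g x.toReal := hg.comp ENNReal.measurable_toReal
  have hA : MeasurableSet {x : ℝ≥0∞ | x ≠ ∞ ∧ x.toReal ∈ B} :=
    (measurableSet_singleton ∞).compl.inter (ENNReal.measurable_toReal hB)
  calc ∫⁻ x in {x | x ≠ ∞ ∧ x.toReal ∈ B}, g x.toReal ∂(P.map (nearestDist M s u Φ state k c))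
      = ∫⁻ ω in (fun ω => (nearestDist M s u Φ state k c ω).toReal) ⁻¹' B,
          g (nearestDist M s u Φ state k c ω).toReal
            ∂(P.restrict {ω | nearestDist M s u Φ state k c ω ≠ ∞}) := by
        rw [setLIntegral_map hA hg' hV,
          Measure.restrict_restrict (hV.ennreal_toReal hB), Set.inter_comm]
        rfl
    _ = ∫⁻ y in B, g y ∂(volume.withDensity fun v => ENNReal.ofReal (M.nearestPDF o s k c v)) := by
        rw [← h.map_toReal_nearestDist, setLIntegral_map hB hg hV.ennreal_toReal]
    _ = ∫⁻ y in B, ENNReal.ofReal (M.nearestPDF o s k c y) * g y :=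
        setLIntegral_withDensity_eq_setLIntegral_mul _
          (M.measurable_nearestPDF o s k c).ennreal_ofReal hg hB

end IsPoissonNetwork

end Nearest

theorem measure_prodMk_mem_of_indepFun {Ω α β : Type*} [MeasurableSpace Ω] [MeasurableSpace α]
    [MeasurableSpace β] {P : Measure Ω} [IsFiniteMeasure P] {X : Ω → α} {Z : Ω → β}
    (h : X ⟂ᵢ[P] Z) (hX : Measurable X) (hZ : Measurable Z) {S : Set (α × β)}
    (hS : MeasurableSet S) :
    P {ω | (X ω, Z ω) ∈ S} = ∫⁻ x, P {ω | (x, Z ω) ∈ S} ∂(P.map X) := by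
  calc P {ω | (X ω, Z ω) ∈ S} = (P.map fun ω => (X ω, Z ω)) S :=
        (Measure.map_apply (hX.prodMk hZ) hS).symm
    _ = ∫⁻ x, P.map Z (Prod.mk x ⁻¹' S) ∂(P.map X) := by
        rw [(indepFun_iff_map_prod_eq_prod_map_map hX.aemeasurable hZ.aemeasurable).1 h,
          Measure.prod_apply hS]
    _ = ∫⁻ x, P {ω | (x, Z ω) ∈ S} ∂(P.map X) :=
        lintegral_congr fun x => Measure.map_apply hZ (measurable_prodMk_left hS)

theorem measure_mem_and_forall_mem_of_iIndepFun {Ω ι : Type*} [MeasurableSpace Ω] {P : Measure Ω}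
    {β : ι → Type*} [∀ p, MeasurableSpace (β p)] {V : ∀ p, Ω → β p} (h : iIndepFun V P)
    (hV : ∀ p, Measurable (V p)) {i : ι} {I : Finset ι} (hi : i ∉ I) {A : Set (β i)}
    (hA : MeasurableSet A) {S : ∀ p, Set (β i × β p)} (hS : ∀ p, MeasurableSet (S p)) :
    P {ω | V i ω ∈ A ∧ ∀ p ∈ I, (V i ω, V p ω) ∈ S p} =
      ∫⁻ x in A, ∏ p ∈ I, P {ω | (x, V p ω) ∈ S p} ∂(P.map (V i)) := by
  have := h.isProbabilityMeasure
  let Z : Ω → ∀ p : I, β p := fun ω p => V p ω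
  let T : Set (β i × ∀ p : I, β p) := {x | x.1 ∈ A ∧ ∀ p : I, (x.1, x.2 p) ∈ S p}
  have hindep : V i ⟂ᵢ[P] Z :=
    (h.indepFun_finset {i} I (Finset.disjoint_singleton_left.2 hi) hV).comp
      (measurable_pi_apply (⟨i, Finset.mem_singleton_self i⟩ : ({i} : Finset ι))) measurable_id
  have hT : MeasurableSet T := by
    simp only [T, Set.ofPred_and, Set.ofPred_forall]
    exact (measurable_fst hA).inter (MeasurableSet.iInter fun p =>
      (measurable_fst.prodMk ((measurable_pi_apply p).comp measurable_snd)) (hS p))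
  have hslice : ∀ x, P {ω | (x, Z ω) ∈ T} =
      A.indicator (fun x => ∏ p ∈ I, P {ω | (x, V p ω) ∈ S p}) x := fun x => by
    by_cases hx : x ∈ A
    · rw [Set.indicator_of_mem hx]
      refine Eq.trans (congrArg P ?_) (h.measure_inter_preimage_eq_mul I
        (sets := fun p => Prod.mk x ⁻¹' S p) fun p _ => measurable_prodMk_left (hS p))
      ext ω
      simp [T, Z, hx]
    · simp [T, hx]
  have hset : {ω | V i ω ∈ A ∧ ∀ p ∈ I, (V i ω, V p ω) ∈ S p} = {ω | (V i ω, Z ω) ∈ T} := by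
    ext ω
    simp [T, Z]
  rw [hset, measure_prodMk_mem_of_indepFun hindep (hV i) (measurable_pi_lambda Z fun p => hV p) hT]
  exact (lintegral_congr hslice).trans (lintegral_indicator hA _)

theorem ofReal_mul_inv_le_iff {B B' x x' : ℝ} (hB : 0 < B) (hB' : 0 < B') (hx : 0 ≤ x)
    (hx' : 0 ≤ x') :
    ENNReal.ofReal B' * (ENNReal.ofReal x')⁻¹ ≤ ENNReal.ofReal B * (ENNReal.ofReal x)⁻¹ ↔
      x * B' / B ≤ x' := by
  rcases hx.eq_or_lt with rfl | hx
  · simp [ENNReal.mul_top, hB, hx']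
  rcases hx'.eq_or_lt with rfl | hx'
  · have h1 : 0 < x * B' / B := by positivity
    have h2 : ENNReal.ofReal B * (ENNReal.ofReal x)⁻¹ < ∞ :=
      ENNReal.mul_lt_top ENNReal.ofReal_lt_top (by simp [hx])
    simp [ENNReal.mul_top, hB', h2.ne, h1.not_ge]
  · rw [← ENNReal.ofReal_inv_of_pos hx, ← ENNReal.ofReal_inv_of_pos hx',
      ← ENNReal.ofReal_mul hB'.le, ← ENNReal.ofReal_mul hB.le,
      ENNReal.ofReal_le_ofReal_iff (by positivity), ← div_eq_mul_inv, ← div_eq_mul_inv,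
      div_le_div_iff₀ hx' hx, div_le_iff₀ hB, mul_comm B', mul_comm B]

namespace Network

variable {K : ℕ} (M : Network K) (o : Subject) (a : Criterion) (s t k : Fin (K + 1))
  (c c' : Channel)

theorem metric_le_metric_iff {d d' : ℝ} (hd : 0 ≤ d) (hd' : 0 ≤ d') :
    M.metric a k c' d' ≤ M.metric a t c d ↔ M.exclusion a t c k c' d ≤ d' := by
  have hk := M.bias_pos k
  have ht := M.bias_pos t
  cases a with
  | nearest => exact ofReal_mul_inv_le_iff ht hk hd hd'
  | strongest =>
    have hα := M.pathloss_pos c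
    have hα' := M.pathloss_pos c'
    simp only [metric, exclusion]
    rw [ENNReal.rpow_neg, ENNReal.rpow_neg, ENNReal.ofReal_rpow_of_nonneg hd hα.le,
      ENNReal.ofReal_rpow_of_nonneg hd' hα'.le,
      ofReal_mul_inv_le_iff ht hk (Real.rpow_nonneg hd _) (Real.rpow_nonneg hd' _), one_div,
      Real.rpow_inv_le_iff_of_pos (by positivity) hd' hα']

theorem exclusion_le_iff_le_exclusion {d d' : ℝ} (hd : 0 ≤ d) (hd' : 0 ≤ d') :
    M.exclusion a k c' t c d' ≤ d ↔ d' ≤ M.exclusion a t c k c' d := by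
  have hk := M.bias_pos k
  have ht := M.bias_pos t
  cases a with
  | nearest => rw [exclusion, exclusion, div_le_iff₀ hk, le_div_iff₀ ht]
  | strongest =>
    have hα := M.pathloss_pos c
    have hα' := M.pathloss_pos c'
    rw [exclusion, exclusion, one_div, one_div,
      Real.rpow_inv_le_iff_of_pos (by positivity) hd hα,
      Real.le_rpow_inv_iff_of_pos hd' (by positivity) hα', div_le_iff₀ hk, le_div_iff₀ ht]

theorem metric_lt_metric_iff {d d' : ℝ} (hd : 0 ≤ d) (hd' : 0 ≤ d') :
    M.metric a k c' d' < M.metric a t c d ↔ M.exclusion a t c k c' d < d' := by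
  rw [← not_le, M.metric_le_metric_iff a k t c' c hd' hd,
    M.exclusion_le_iff_le_exclusion a t k c c' hd hd', not_le]

theorem exclusion_nonneg {d : ℝ} (hd : 0 ≤ d) : 0 ≤ M.exclusion a t c k c' d := by
  have hk := M.bias_pos k
  have ht := M.bias_pos t
  cases a <;> simp only [exclusion] <;> positivity

theorem exclusion_self {d : ℝ} (hd : 0 ≤ d) : M.exclusion a t c t c d = d := by
  have ht := M.bias_pos t
  cases a <;> simp only [exclusion]
  · rw [mul_div_cancel_right₀ _ ht.ne']
  · rw [mul_div_cancel_right₀ _ ht.ne', one_div, Real.rpow_rpow_inv hd (M.pathloss_pos c).ne']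

theorem measurable_exclusion : Measurable (M.exclusion a t c k c') := by
  cases a
  · exact (measurable_id.mul_const _).div_const _
  · exact (((measurable_id.pow_const _).mul_const _).div_const _).pow_const _

theorem measurable_nearestCCDF_exclusion :
    Measurable fun y => M.nearestCCDF o s k c' (M.exclusion a t c k c' y) :=
  (M.measurable_nearestCCDF o s k c').comp (M.measurable_exclusion a t k c c')

theorem measurable_mainLinkWeight : Measurable (M.mainLinkWeight o a s t c) :=
  (M.measurable_nearestPDF o s t c).mul (Finset.measurable_fun_prod _ fun p _ =>
    M.measurable_nearestCCDF_exclusion o a s t p.1 c p.2)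

theorem mainLinkWeight_nonneg (y : ℝ) : 0 ≤ M.mainLinkWeight o a s t c y :=
  mul_nonneg (M.nearestPDF_nonneg o s t c y)
    (Finset.prod_nonneg fun p _ => M.nearestCCDF_nonneg o s p.1 p.2 _)

theorem mainLinkWeight_of_neg {y : ℝ} (hy : y < 0) : M.mainLinkWeight o a s t c y = 0 := by
  rw [mainLinkWeight, nearestPDF, if_pos (hy.trans_le (M.gap_nonneg s t)), zero_mul]

theorem mainLinkPDF_eq (y : ℝ) :
    M.mainLinkPDF o a s t c y = (M.assocProb o a s t c)⁻¹ * M.mainLinkWeight o a s t c y := by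
  rw [mainLinkPDF, mainLinkWeight]
  ring

theorem measurable_mainLinkPDF : Measurable (M.mainLinkPDF o a s t c) := by
  simp_rw [funext (M.mainLinkPDF_eq o a s t c)]
  exact (M.measurable_mainLinkWeight o a s t c).const_mul _

theorem setLIntegral_mainLinkWeight_Ioi :
    ∫⁻ y in Set.Ioi 0, ENNReal.ofReal (M.mainLinkWeight o a s t c y) =
      ∫⁻ y, ENNReal.ofReal (M.mainLinkWeight o a s t c y) := by
  rw [restrict_Ioi_eq_restrict_Ici]
  refine setLIntegral_eq_of_support_subset fun y hy => ?_
  by_contra hneg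
  refine hy (?_ : ENNReal.ofReal (M.mainLinkWeight o a s t c y) = 0)
  rw [M.mainLinkWeight_of_neg o a s t c (not_le.1 hneg), ENNReal.ofReal_zero]

end Network

section Association

variable {K : ℕ} {Ω : Type*} [MeasurableSpace Ω] {M : Network K} {o : Subject} {a : Criterion}
  {s t : Fin (K + 1)} {c : Channel} {u : Plane} {P : Measure Ω}
  {Φ : Fin (K + 1) → RandomPoints Ω} {state : Fin (K + 1) × ℕ → Ω → Channel}
  {sel : Ω → Option (Fin (K + 1) × ℕ)} {ω : Ω}

/-- The event that there is a node of type `(t, c)`, and that the nearest such node has a strictly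
larger association metric than the nodes of all other types. It is expressed through the
nearest-node distances alone, and agrees almost surely with `assocEvent`. -/
def nearestWins (M : Network K) (a : Criterion) (s : Fin (K + 1)) (u : Plane)
    (Φ : Fin (K + 1) → RandomPoints Ω) (state : Fin (K + 1) × ℕ → Ω → Channel)
    (t : Fin (K + 1)) (c : Channel) : Set Ω :=
  {ω | nearestDist M s u Φ state t c ω ≠ ∞ ∧ ∀ p ≠ (t, c),
    nearestDist M s u Φ state p.1 p.2 ω ∈
      exceeding (M.exclusion a t c p.1 p.2 (nearestDist M s u Φ state t c ω).toReal)}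

/-- The nearest node of type `(t, c)` and the nearest node of type `p` have the same association
metric. -/
def IsTie (M : Network K) (a : Criterion) (s : Fin (K + 1)) (u : Plane)
    (Φ : Fin (K + 1) → RandomPoints Ω) (state : Fin (K + 1) × ℕ → Ω → Channel)
    (t : Fin (K + 1)) (c : Channel) (p : Fin (K + 1) × Channel) (ω : Ω) : Prop :=
  nearestDist M s u Φ state t c ω ≠ ∞ ∧ nearestDist M s u Φ state p.1 p.2 ω =
    ENNReal.ofReal (M.exclusion a t c p.1 p.2 (nearestDist M s u Φ state t c ω).toReal)

theorem IsBest.exclusion_le_nearestDist {q : Fin (K + 1) × ℕ} (h : IsBest M a s u Φ state q ω)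
    (k : Fin (K + 1)) (c : Channel) :
    ENNReal.ofReal (M.exclusion a q.1 (state q ω) k c (nodeDist M s u Φ q ω)) ≤
      nearestDist M s u Φ state k c ω := by
  refine le_iInf₂ fun n hn => ENNReal.ofReal_le_ofReal ?_
  obtain ⟨hnode, rfl⟩ := hn
  exact (M.metric_le_metric_iff a q.1 k (state q ω) (state (k, n) ω)
    (nodeDist_nonneg q ω) (nodeDist_nonneg (k, n) ω)).1 (h.2 (k, n) hnode)

theorem IsBest.nearestDist_eq {q : Fin (K + 1) × ℕ} (h : IsBest M a s u Φ state q ω) :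
    nearestDist M s u Φ state q.1 (state q ω) ω = ENNReal.ofReal (nodeDist M s u Φ q ω) := by
  have hle := h.exclusion_le_nearestDist q.1 (state q ω)
  rw [M.exclusion_self a q.1 _ (nodeDist_nonneg q ω)] at hle
  exact (nearestDist_le h.1).antisymm hle

theorem IsBest.mem_nearestWins {q : Fin (K + 1) × ℕ} (h : IsBest M a s u Φ state q ω)
    (htie : ∀ p ≠ (q.1, state q ω), ¬ IsTie M a s u Φ state q.1 (state q ω) p ω) :
    ω ∈ nearestWins M a s u Φ state q.1 (state q ω) := by
  have hV : nearestDist M s u Φ state q.1 (state q ω) ω ≠ ∞ :=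
    h.nearestDist_eq ▸ ENNReal.ofReal_ne_top
  refine ⟨hV, fun p hp => ?_⟩
  rw [mem_exceeding_iff_of_nonneg (M.exclusion_nonneg _ _ _ _ _ ENNReal.toReal_nonneg)]
  refine lt_of_le_of_ne ?_ fun heq => htie p hp ⟨hV, heq.symm⟩
  rw [h.nearestDist_eq, ENNReal.toReal_ofReal (nodeDist_nonneg q ω)]
  exact h.exclusion_le_nearestDist p.1 p.2

theorem exists_isBest_of_mem_nearestWins (hfin : LocallyFinite M s u Φ ω)
    (h : ω ∈ nearestWins M a s u Φ state t c) :
    ∃ n, state (t, n) ω = c ∧ IsBest M a s u Φ state (t, n) ω ∧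
      ∀ q, IsNode Φ q ω → (q.1, state q ω) ≠ (t, c) →
        M.metric a q.1 (state q ω) (nodeDist M s u Φ q ω) <
          M.metric a t c (nodeDist M s u Φ (t, n) ω) := by
  obtain ⟨n, hn, rfl, hd⟩ := hfin.exists_eq_nearestDist h.1
  have hlt : ∀ q, IsNode Φ q ω → (q.1, state q ω) ≠ (t, state (t, n) ω) →
      M.metric a q.1 (state q ω) (nodeDist M s u Φ q ω) <
        M.metric a t (state (t, n) ω) (nodeDist M s u Φ (t, n) ω) := fun q hq hne => by
    have hex := isUpperSet_exceeding _ (nearestDist_le hq) (h.2 (q.1, state q ω) hne)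
    rw [hd, ENNReal.toReal_ofReal (nodeDist_nonneg _ ω)] at hex
    exact (M.metric_lt_metric_iff a t q.1 _ _ (nodeDist_nonneg _ ω) (nodeDist_nonneg q ω)).2
      ((ofReal_mem_exceeding_iff (nodeDist_nonneg q ω)).1 hex)
  refine ⟨n, rfl, ⟨hn, fun q hq => ?_⟩, hlt⟩
  by_cases htype : (q.1, state q ω) = (t, state (t, n) ω)
  · obtain ⟨hk, hc⟩ := Prod.ext_iff.1 htype
    have hle := nearestDist_le (M := M) (s := s) (u := u) (state := state) hq
    simp only at hk hc
    rw [hk, hc, hd, ENNReal.ofReal_le_ofReal_iff (nodeDist_nonneg q ω)] at hle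
    rw [hk, hc, M.metric_le_metric_iff a t t _ _ (nodeDist_nonneg _ ω) (nodeDist_nonneg q ω),
      M.exclusion_self a t _ (nodeDist_nonneg _ ω)]
    exact hle
  · exact (hlt q hq htype).le

theorem mem_assocEvent_of_mem_nearestWins (hfin : LocallyFinite M s u Φ ω)
    (hsome : ∀ p, sel ω = some p → IsBest M a s u Φ state p ω)
    (hnone : sel ω = none → ∀ p, ¬ IsBest M a s u Φ state p ω)
    (h : ω ∈ nearestWins M a s u Φ state t c) : ω ∈ assocEvent state sel t c := by
  obtain ⟨n, rfl, hbest, hlt⟩ := exists_isBest_of_mem_nearestWins hfin h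
  obtain ⟨⟨k, m⟩, hsel⟩ := Option.ne_none_iff_exists'.1 fun hsel => hnone hsel _ hbest
  have htype : (k, state (k, m) ω) = (t, state (t, n) ω) := by
    by_contra hne
    exact (hlt (k, m) (hsome _ hsel).1 hne).not_ge ((hsome _ hsel).2 (t, n) hbest.1)
  obtain ⟨rfl, hc⟩ := Prod.ext_iff.1 htype
  exact ⟨m, hsel, hc⟩

theorem mainLinkDist_eq_of_mem_assocEvent
    (hsome : ∀ p, sel ω = some p → IsBest M a s u Φ state p ω)
    (h : ω ∈ assocEvent state sel t c) :
    mainLinkDist M s u Φ sel ω = (nearestDist M s u Φ state t c ω).toReal := by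
  obtain ⟨n, hsel, rfl⟩ := h
  rw [(hsome _ hsel).nearestDist_eq, ENNReal.toReal_ofReal (nodeDist_nonneg _ ω), mainLinkDist,
    hsel]

theorem measurableSet_exceeding_exclusion (p : Fin (K + 1) × Channel) :
    MeasurableSet {x : ℝ≥0∞ × ℝ≥0∞ | x.2 ∈ exceeding (M.exclusion a t c p.1 p.2 x.1.toReal)} :=
  measurableSet_lt ((M.measurable_exclusion a t p.1 c p.2).comp
    measurable_fst.ennreal_toReal).coe_real_ereal measurable_snd.coe_ereal_ennreal

theorem IsLinkState.measurableSet_nearestWins (h : IsLinkState M o s u Φ state P)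
    (a : Criterion) (t : Fin (K + 1)) (c : Channel) :
    MeasurableSet (nearestWins M a s u Φ state t c) := by
  have hV := h.measurable_nearestDist
  simp only [nearestWins, Set.ofPred_and, Set.ofPred_forall]
  exact (hV t c (measurableSet_singleton ∞).compl).inter (MeasurableSet.iInter fun p =>
    MeasurableSet.iInter fun _ =>
      ((hV t c).prodMk (hV p.1 p.2)) (measurableSet_exceeding_exclusion p))

namespace IsPoissonNetwork

variable [IsProbabilityMeasure P]

theorem measure_nearestWins_inter (h : IsPoissonNetwork M o s u Φ state P) (a : Criterion)
    (t : Fin (K + 1)) (c : Channel) {B : Set ℝ} (hB : MeasurableSet B) :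
    P (nearestWins M a s u Φ state t c ∩
        (fun ω => (nearestDist M s u Φ state t c ω).toReal) ⁻¹' B) =
      ∫⁻ y in B, ENNReal.ofReal (M.mainLinkWeight o a s t c y) := by
  let I := (Finset.univ : Finset (Fin (K + 1) × Channel)).erase (t, c)
  let A : Set ℝ≥0∞ := {x | x ≠ ∞ ∧ x.toReal ∈ B}
  have hA : MeasurableSet A :=
    (measurableSet_singleton ∞).compl.inter (ENNReal.measurable_toReal hB)
  calc P (nearestWins M a s u Φ state t c ∩
        (fun ω => (nearestDist M s u Φ state t c ω).toReal) ⁻¹' B)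
      = P {ω | nearestDist M s u Φ state t c ω ∈ A ∧ ∀ p ∈ I,
          nearestDist M s u Φ state p.1 p.2 ω ∈
            exceeding (M.exclusion a t c p.1 p.2 (nearestDist M s u Φ state t c ω).toReal)} := by
        congr 1
        ext ω
        simp only [nearestWins, A, I, Set.mem_inter_iff, Set.mem_preimage, Set.mem_ofPred_eq,
          Finset.mem_erase, Finset.mem_univ, and_true]
        tauto
    _ = ∫⁻ x in A, ∏ p ∈ I, P (nearestDist M s u Φ state p.1 p.2 ⁻¹'
          exceeding (M.exclusion a t c p.1 p.2 x.toReal))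
            ∂(P.map (nearestDist M s u Φ state t c)) :=
        measure_mem_and_forall_mem_of_iIndepFun h.iIndepFun_nearestDist
          (fun p => h.isLinkState.measurable_nearestDist p.1 p.2)
          (Finset.notMem_erase (t, c) Finset.univ) hA measurableSet_exceeding_exclusion
    _ = ∫⁻ y in B, ENNReal.ofReal (M.nearestPDF o s t c y) *
          ∏ p ∈ I, ENNReal.ofReal (M.nearestCCDF o s p.1 p.2 (M.exclusion a t c p.1 p.2 y)) := by
        simp_rw [h.measure_exceeding]
        exact h.setLIntegral_comp_toReal_map_nearestDist t c
          (g := fun y => ∏ p ∈ I,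
            ENNReal.ofReal (M.nearestCCDF o s p.1 p.2 (M.exclusion a t c p.1 p.2 y)))
          (Finset.measurable_fun_prod _ fun p _ =>
            (M.measurable_nearestCCDF_exclusion o a s t p.1 c p.2).ennreal_ofReal) hB
    _ = ∫⁻ y in B, ENNReal.ofReal (M.mainLinkWeight o a s t c y) := by
        refine lintegral_congr fun y => ?_
        rw [Network.mainLinkWeight, ENNReal.ofReal_mul (M.nearestPDF_nonneg o s t c y),
          ENNReal.ofReal_prod_of_nonneg fun p _ => M.nearestCCDF_nonneg o s p.1 p.2 _]

theorem ae_not_isTie (h : IsPoissonNetwork M o s u Φ state P) (a : Criterion) (t : Fin (K + 1))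
    (c : Channel) {p : Fin (K + 1) × Channel} (hp : p ≠ (t, c)) :
    ∀ᵐ ω ∂P, ¬ IsTie M a s u Φ state t c p ω := by
  let S : Set (ℝ≥0∞ × ℝ≥0∞) := {x | x.1 ≠ ∞ ∧
    x.2 = ENNReal.ofReal (M.exclusion a t c p.1 p.2 x.1.toReal)}
  have hS : MeasurableSet S := (measurable_fst (measurableSet_singleton ∞).compl).inter
    (measurableSet_eq_fun measurable_snd ((M.measurable_exclusion a t p.1 c p.2).comp
      measurable_fst.ennreal_toReal).ennreal_ofReal)
  have hslice : ∀ x, P {ω | (x, nearestDist M s u Φ state p.1 p.2 ω) ∈ S} = 0 := fun x =>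
    measure_mono_null (fun ω hω => hω.2) (h.measure_nearestDist_eq_ofReal p.1 p.2
      (M.exclusion a t c p.1 p.2 x.toReal))
  have hmeas := h.isLinkState.measurable_nearestDist
  have hzero := measure_prodMk_mem_of_indepFun (h.iIndepFun_nearestDist.indepFun hp.symm)
    (hmeas t c) (hmeas p.1 p.2) hS
  simp_rw [hslice, lintegral_zero] at hzero
  exact measure_eq_zero_iff_ae_notMem.1 hzero

theorem assocEvent_ae_eq (h : IsPoissonNetwork M o s u Φ state P)
    (hsel : IsAssociation M a s u Φ state sel P) (t : Fin (K + 1)) (c : Channel) :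
    assocEvent state sel t c =ᵐ[P] nearestWins M a s u Φ state t c := by
  have htie : ∀ᵐ ω ∂P, ∀ p ≠ (t, c), ¬ IsTie M a s u Φ state t c p ω :=
    ae_all_iff.2 fun p => eventually_imp_distrib_left.2 fun hp => h.ae_not_isTie a t c hp
  filter_upwards [ae_locallyFinite h.isPoisson, hsel, htie] with ω hfin hsel htie
  refine propext ⟨?_, mem_assocEvent_of_mem_nearestWins hfin hsel.1 hsel.2⟩
  rintro ⟨n, hn, rfl⟩
  exact (hsel.1 _ hn).mem_nearestWins htie

theorem setLIntegral_mainLinkWeight (h : IsPoissonNetwork M o s u Φ state P) (a : Criterion)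
    (t : Fin (K + 1)) (c : Channel) :
    ∫⁻ y in Set.Ioi 0, ENNReal.ofReal (M.mainLinkWeight o a s t c y) =
      P (nearestWins M a s u Φ state t c) := by
  rw [M.setLIntegral_mainLinkWeight_Ioi, ← setLIntegral_univ,
    ← h.measure_nearestWins_inter a t c MeasurableSet.univ, Set.preimage_univ, Set.inter_univ]

theorem integrableOn_mainLinkWeight (h : IsPoissonNetwork M o s u Φ state P) (a : Criterion)
    (t : Fin (K + 1)) (c : Channel) : IntegrableOn (M.mainLinkWeight o a s t c) (Set.Ioi 0) := by
  refine ⟨(M.measurable_mainLinkWeight o a s t c).aestronglyMeasurable, ?_⟩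
  rw [hasFiniteIntegral_iff_ofReal (ae_of_all _ (M.mainLinkWeight_nonneg o a s t c)),
    h.setLIntegral_mainLinkWeight]
  exact measure_lt_top P _

theorem measure_nearestWins (h : IsPoissonNetwork M o s u Φ state P) (a : Criterion)
    (t : Fin (K + 1)) (c : Channel) :
    P (nearestWins M a s u Φ state t c) = ENNReal.ofReal (M.assocProb o a s t c) := by
  rw [Network.assocProb, ofReal_integral_eq_lintegral_ofReal (h.integrableOn_mainLinkWeight a t c)
    (ae_of_all _ (M.mainLinkWeight_nonneg o a s t c)), h.setLIntegral_mainLinkWeight]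

theorem measure_assocEvent (h : IsPoissonNetwork M o s u Φ state P)
    (hsel : IsAssociation M a s u Φ state sel P) (t : Fin (K + 1)) (c : Channel) :
    P (assocEvent state sel t c) = ENNReal.ofReal (M.assocProb o a s t c) :=
  (measure_congr (h.assocEvent_ae_eq hsel t c)).trans (h.measure_nearestWins a t c)

theorem cond_assocEvent (h : IsPoissonNetwork M o s u Φ state P)
    (hsel : IsAssociation M a s u Φ state sel P) (t : Fin (K + 1)) (c : Channel) :
    P[|assocEvent state sel t c] = P[|nearestWins M a s u Φ state t c] := by
  have hae := h.assocEvent_ae_eq hsel t c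
  rw [ProbabilityTheory.cond, ProbabilityTheory.cond, measure_congr hae,
    Measure.restrict_congr_set hae]

theorem mainLinkDist_ae_eq (h : IsPoissonNetwork M o s u Φ state P)
    (hsel : IsAssociation M a s u Φ state sel P) (t : Fin (K + 1)) (c : Channel) :
    mainLinkDist M s u Φ sel =ᵐ[P[|assocEvent state sel t c]]
      fun ω => (nearestDist M s u Φ state t c ω).toReal := by
  rw [h.cond_assocEvent hsel]
  refine Measure.smul_absolutelyContinuous.ae_le
    ((ae_restrict_iff' (h.isLinkState.measurableSet_nearestWins a t c)).2 ?_)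
  filter_upwards [h.assocEvent_ae_eq hsel t c, hsel] with ω hiff hbest hω
  exact mainLinkDist_eq_of_mem_assocEvent hbest.1 (hiff.mpr hω)

theorem aemeasurable_mainLinkDist (h : IsPoissonNetwork M o s u Φ state P)
    (hsel : IsAssociation M a s u Φ state sel P) (t : Fin (K + 1)) (c : Channel) :
    AEMeasurable (mainLinkDist M s u Φ sel) P[|assocEvent state sel t c] :=
  (h.isLinkState.measurable_nearestDist t c).ennreal_toReal.aemeasurable.congr
    (h.mainLinkDist_ae_eq hsel t c).symm

theorem map_mainLinkDist (h : IsPoissonNetwork M o s u Φ state P)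
    (hsel : IsAssociation M a s u Φ state sel P)
    (hpos : P (assocEvent state sel t c) ≠ 0) :
    P[|assocEvent state sel t c].map (mainLinkDist M s u Φ sel) =
      volume.withDensity fun y => ENNReal.ofReal (M.mainLinkPDF o a s t c y) := by
  have hV := (h.isLinkState.measurable_nearestDist t c).ennreal_toReal
  rw [h.measure_assocEvent hsel, ne_eq, ENNReal.ofReal_eq_zero, not_le] at hpos
  rw [Measure.map_congr (h.mainLinkDist_ae_eq hsel t c), h.cond_assocEvent hsel]
  ext B hB
  calc P[|nearestWins M a s u Φ state t c].map
        (fun ω => (nearestDist M s u Φ state t c ω).toReal) B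
      = (ENNReal.ofReal (M.assocProb o a s t c))⁻¹ *
          ∫⁻ y in B, ENNReal.ofReal (M.mainLinkWeight o a s t c y) := by
        rw [Measure.map_apply hV hB, cond_apply (h.isLinkState.measurableSet_nearestWins a t c),
          h.measure_nearestWins_inter a t c hB, h.measure_nearestWins]
    _ = ∫⁻ y in B, ENNReal.ofReal (M.mainLinkPDF o a s t c y) := by
        rw [← ENNReal.ofReal_inv_of_pos hpos,
          ← lintegral_const_mul _ (M.measurable_mainLinkWeight o a s t c).ennreal_ofReal]
        refine lintegral_congr fun y => ?_
        rw [M.mainLinkPDF_eq, ENNReal.ofReal_mul (inv_nonneg.2 hpos.le)]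
    _ = volume.withDensity (fun y => ENNReal.ofReal (M.mainLinkPDF o a s t c y)) B :=
        (withDensity_apply _ hB).symm

end IsPoissonNetwork

end Association

end AerialNet

end

theorem lemma1 {K : ℕ} (M : AerialNet.Network K)
    (o : AerialNet.Subject) (a : AerialNet.Criterion)
    -- receiver layer `i`, transmitter layer `j`, channel `c` of the main link
    (i j : Fin (K + 1)) (c : AerialNet.Channel)
    -- layers of the selecting and of the selected end of the main link
    (s t : Fin (K + 1)) (hs : s = o.selecting i j) (ht : t = o.selected i j)
    -- horizontal position of the selecting node
    (u : AerialNet.Plane)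
    {Ω : Type*} [MeasurableSpace Ω] (P : Measure Ω) [IsProbabilityMeasure P]
    -- the nodes among which the selecting node chooses: independent Poisson processes
    (Φ : Fin (K + 1) → AerialNet.RandomPoints Ω)
    (hΦ : ∀ k, (Φ k).IsPoisson P (M.density o.candidates k))
    (hindep : iIndep (fun k => (Φ k).sigma) P)
    -- the states of the links from the selecting node
    (state : Fin (K + 1) × ℕ → Ω → AerialNet.Channel)
    (hstate : AerialNet.IsLinkState M o s u Φ state P)
    -- the associated node
    (sel : Ω → Option (Fin (K + 1) × ℕ))
    (hsel : AerialNet.IsAssociation M a s u Φ state sel P) :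
    -- CCDF and PDF of the nearest-node distances
    (∀ (k : Fin (K + 1)) (c' : AerialNet.Channel),
      (∀ v : ℝ, P {ω | (v : EReal) < (AerialNet.nearestDist M s u Φ state k c' ω : EReal)} =
        ENNReal.ofReal (M.nearestCCDF o s k c' v)) ∧
      (∀ B : Set ℝ, MeasurableSet B →
        P {ω | AerialNet.nearestDist M s u Φ state k c' ω ≠ ∞ ∧
            (AerialNet.nearestDist M s u Φ state k c' ω).toReal ∈ B} =
          ∫⁻ v in B, ENNReal.ofReal (M.nearestPDF o s k c' v))) ∧
    -- association probability
    (IntegrableOn (M.mainLinkWeight o a s t c) (Set.Ioi 0) ∧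
      P (AerialNet.assocEvent state sel t c) = ENNReal.ofReal (M.assocProb o a s t c)) ∧
    -- PDF of the main link distance, given the association
    (P (AerialNet.assocEvent state sel t c) ≠ 0 →
      HasPDF (AerialNet.mainLinkDist M s u Φ sel)
        (ProbabilityTheory.cond P (AerialNet.assocEvent state sel t c)) volume ∧
      pdf (AerialNet.mainLinkDist M s u Φ sel)
          (ProbabilityTheory.cond P (AerialNet.assocEvent state sel t c)) volume =ᵐ[volume]
        fun y => ENNReal.ofReal (M.mainLinkPDF o a s t c y)) := by
  have h : AerialNet.IsPoissonNetwork M o s u Φ state P := ⟨hΦ, hindep, hstate⟩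
  refine ⟨fun k c' => ⟨fun v => h.measure_exceeding (k, c') v,
    fun B hB => h.measure_nearestDist_mem k c' hB⟩,
    ⟨h.integrableOn_mainLinkWeight a t c, h.measure_assocEvent hsel t c⟩, fun hpos => ?_⟩
  have hf := (M.measurable_mainLinkPDF o a s t c).ennreal_ofReal.aemeasurable (μ := volume)
  have hmap := h.map_mainLinkDist hsel hpos
  have hpdf := hasPDF_of_map_eq_withDensity (h.aemeasurable_mainLinkDist hsel t c) _ hf hmap
  exact ⟨hpdf, (pdf.eq_of_map_eq_withDensity _ hf).1 hmap⟩
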